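/- Let $N\ge 1$. Consider $N$ plane non-magnetic layers, numbered $1,\dots,N$, with thicknesses $d_j>0$, between two half-spaces (media $0$ and $N+1$) with constant refractive indices $n_0,n_{N+1}>0$ (for instance vacuum, $n_0=n_{N+1}=1$), at normal incidence. The layers are Lorentz-dispersive: $$n_j^2(\omega)=1+\frac{f_j}{\omega_j^2-\omega^2-i\Gamma_j\omega},\qquad 1\le j\le N,$$ with $\omega_j>0$, $f_j>0$, $\Gamma_j\ge 0$. Let $c>0$ be the speed of light, $\delta_m=n_m d_m\omega/c$, and $g_m=n_m$ (TE polarization) or $g_m=1/n_m$ (TM polarization). The numerator $Z_m$ and the denominator $N_m$ of the reflection coefficient for $m$ interfaces are given by Wolter's recursion: $Z_1=g_1-g_0$, $N_1=g_1+g_0$, and for $m\ge 2$ $$Z_m=(g_m-g_{m-1})e^{-i\delta_{m-1}}N_{m-1}+(g_m+g_{m-1})e^{i\delta_{m-1}}Z_{m-1},$$ $$N_m=(g_m+g_{m-1})e^{-i\delta_{m-1}}N_{m-1}+(g_m-g_{m-1})e^{i\delta_{m-1}}Z_{m-1}.$$ The denominator of the reflection and transmission coefficients of the medium is $\mathcal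 N=N_{N+1}$, regarded as a function of $\omega$. A natural mode frequency is a zero $\omega$ of $\mathcal N$ at which all $n_j$ are finite and nonzero. A resonance of layer $j$ is a root $a\in\mathbb C$ of $\omega_j^2-a^2-i\Gamma_j a=0$. (Each $n_j(\omega)$, $1\le j\le N$, is determined only up to sign, and $\mathcal N$ changes at most its sign with the choice; hence $\mathcal N^2$ and the natural mode frequencies do not depend on the choice.) Then, for TE and for TM polarization, at every resonance $a$ of every layer: 1. $a$ is an essential singularity of the denominator: the single-valued function $\mathcal N^2$ has an isolated essential singularity at $\omega=a$; moreover, in the local coordinate $t$ given by $\omega=a+t^2$ all the $n_j$ have holomorphic branches in a punctured neighbourhood of $t=0$, and for every such choice of branches $\mathcal N$ itself has an isolated essential singularity at $t=0$. 2. Every neighbourhood of $a$ contains infinitely many natural mode frequencies. At every point of $\mathbb C$ that is not a resonance of any layer, $\mathcal N^2$ is meromorphic, so it has no other essential singularities in $\mathbb C$. -/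

import Mathlib

open Filter Topology

noncomputable section

/-- A stratified medium of `N` plane, non-magnetic, Lorentz-dispersive layers, numbered `1, …, N`,
between two half-spaces (media `0` and `N + 1`) with constant refractive indices `nIn`, `nOut`.
Only the values of the layer parameters at `1 ≤ j ≤ N` play a role. -/
structure LorentzStack where
  /-- number of layers -/
  N : ℕ
  /-- speed of light -/
  c : ℝ
  /-- refractive index of medium `0` -/
  nIn : ℝ
  /-- refractive index of medium `N + 1` -/
  nOut : ℝ
  /-- characteristic frequencies -/
  charFreq : ℕ → ℝ
  /-- oscillator strengths -/
  strength : ℕ → ℝ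
  /-- damping coefficients -/
  damping : ℕ → ℝ
  /-- layer thicknesses -/
  thickness : ℕ → ℝ
  c_pos : 0 < c
  nIn_pos : 0 < nIn
  nOut_pos : 0 < nOut
  charFreq_pos : ∀ j, 1 ≤ j → j ≤ N → 0 < charFreq j
  strength_pos : ∀ j, 1 ≤ j → j ≤ N → 0 < strength j
  damping_nonneg : ∀ j, 1 ≤ j → j ≤ N → 0 ≤ damping j
  thickness_pos : ∀ j, 1 ≤ j → j ≤ N → 0 < thickness j

/-- The two polarizations. -/
inductive Polarization where
  | TE
  | TM

/-- Wolter's recursion: `wolter g δ k = (Z_{k+1}, N_{k+1})`, the numerator and the denominator of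
the reflection coefficient of a system with `k + 1` interfaces. -/
def wolter (g δ : ℕ → ℂ) : ℕ → ℂ × ℂ
  | 0 => (g 1 - g 0, g 1 + g 0)
  | k + 1 =>
    ((g (k + 2) - g (k + 1)) * Complex.exp (-Complex.I * δ (k + 1)) * (wolter g δ k).2
        + (g (k + 2) + g (k + 1)) * Complex.exp (Complex.I * δ (k + 1)) * (wolter g δ k).1,
      (g (k + 2) + g (k + 1)) * Complex.exp (-Complex.I * δ (k + 1)) * (wolter g δ k).2
        + (g (k + 2) - g (k + 1)) * Complex.exp (Complex.I * δ (k + 1)) * (wolter g δ k).1)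

/-- The coefficients `g_m` at normal incidence for `μ_m = 1`. -/
def Polarization.coeff : Polarization → (ℕ → ℂ) → ℕ → ℂ
  | .TE, n, m => n m
  | .TM, n, m => 1 / n m

namespace LorentzStack

/-- `ω_j² - ω² - i Γ_j ω`. -/
def lorentzDenom (S : LorentzStack) (j : ℕ) (ω : ℂ) : ℂ :=
  (S.charFreq j : ℂ) ^ 2 - ω ^ 2 - Complex.I * (S.damping j : ℂ) * ω

/-- `ω` is a resonance of layer `j`, i.e. a singularity of its refractive index. -/
def IsResonance (S : LorentzStack) (j : ℕ) (ω : ℂ) : Prop :=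
  1 ≤ j ∧ j ≤ S.N ∧ S.lorentzDenom j ω = 0

/-- The numbers `n 0, …, n (N + 1)` are admissible values at frequency `ω` of the refractive
indices of the media. In the layers the dispersion relation fixes `n j` up to sign; at a resonance
of layer `j` the index of that layer has no value and nothing is asked of `n j`. -/
structure IsIndexAt (S : LorentzStack) (ω : ℂ) (n : ℕ → ℂ) : Prop where
  left : n 0 = (S.nIn : ℂ)
  right : n (S.N + 1) = (S.nOut : ℂ)
  layer : ∀ j, 1 ≤ j → j ≤ S.N → S.lorentzDenom j ω ≠ 0 →
    n j ^ 2 = 1 + (S.strength j : ℂ) / S.lorentzDenom j ω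

/-- The phases `δ_m = n_m d_m ω / c`. -/
def phase (S : LorentzStack) (ω : ℂ) (n : ℕ → ℂ) (m : ℕ) : ℂ :=
  n m * (S.thickness m : ℂ) * ω / (S.c : ℂ)

/-- The common denominator `N_{N+1}` of the reflection and the transmission coefficient of the
stack (which has `N + 1` interfaces) at frequency `ω`, for the values `n` of the indices. -/
def denominator (S : LorentzStack) (p : Polarization) (ω : ℂ) (n : ℕ → ℂ) : ℂ :=
  (wolter (p.coeff n) (S.phase ω n) S.N).2

/-- `ω` is a natural mode frequency: all indices are finite and nonzero at `ω`, and the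
denominator vanishes there. -/
def IsNaturalMode (S : LorentzStack) (p : Polarization) (n : ℂ → ℕ → ℂ) (ω : ℂ) : Prop :=
  (∀ j, 1 ≤ j → j ≤ S.N → S.lorentzDenom j ω ≠ 0 ∧ n ω j ≠ 0) ∧ S.denominator p ω (n ω) = 0

/-- `ν` is a choice of the refractive indices near `a`, written in the local coordinate `t` with
`ω = a + t²`, that is holomorphic in a punctured neighbourhood of `t = 0`. -/
def IsHolomorphicBranch (S : LorentzStack) (a : ℂ) (ν : ℂ → ℕ → ℂ) : Prop :=
  ∀ᶠ t in 𝓝[≠] (0 : ℂ), S.IsIndexAt (a + t ^ 2) (ν t) ∧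
    ∀ j, 1 ≤ j → j ≤ S.N → AnalyticAt ℂ (fun s => ν s j) t

end LorentzStack

/-- `a` is an (isolated) essential singularity of `f`: `f` is holomorphic in a punctured
neighbourhood of `a`, and `a` is neither a removable singularity nor a pole. -/
def IsEssentialSingularity (f : ℂ → ℂ) (a : ℂ) : Prop :=
  (∀ᶠ z in 𝓝[≠] a, AnalyticAt ℂ f z) ∧ ¬ MeromorphicAt f a

end

/-! The entries cos δ, g sin δ and sin δ / g of the characteristic matrix of a layer are even in its
index. Hence the denominator is 2^N ∏ g_m, which alone feels the signs of the n_j, times a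
single-valued function H (`reducedDenom`) that is holomorphic off the resonances (`denominator_eq`).
The square of the first factor is meromorphic everywhere, so everything depends on H near a
resonance a.

Growth. At a the square of a resonant index has a simple or double pole. So for all but finitely
many directions v, every resonant layer satisfies (Im δ)² ≥ c / x at ω = a ± x v. With the root for
which Im δ ≥ 0, exp (-iδ) outgrows every power of 1 / x, and the field leaves a resonant layer as a
huge multiple of (1, g) with negligible relative error (`Follows.layer`). It must not be cancelled
at the next resonant layer or at the last half-space: the interface factor across the nonresonant
block in between needs a polynomially bounded inverse. The product of this factor over the signs of
both end coefficients is meromorphic at a. It does not vanish identically, by continuation to the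
positive imaginary axis, where all indices can be taken positive and all layers attenuate
(`not_eventually_blockProd_eq_zero`). Adjacent layers may be of the same medium; there Im (n ω) ≥ 0
excludes cancellation. So H outgrows every power (`negligible_inv_reducedDenom`), and a is
essential.

Zeros. Fast growth alone does not force zeros: exp (1 / s) has none. But H is exp (O (1 / |ω - a|))
and is large in two opposite directions. If H had no zeros near a, Borel–Carathéodory would bound s²
H' / H with s = ω - a, which would then extend to a holomorphic Q. The logarithmic derivative of H
(a + x v) H (a - x v) would be (Q (x v) - Q (-x v)) / (x² v) = O (1 / x), and the product would grow
only polynomially (`frequently_eq_zero_of_growth`). -/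

open Asymptotics Matrix

/-! ### Polynomial growth and superpolynomial decay along a filter -/

section Asymptotic

variable {ι : Type*} {l : Filter ι} {z : ι → ℝ} {f g : ι → ℂ}

/-- `f` grows at most polynomially in the scale `z` along `l`. -/
def PolyBdd (l : Filter ι) (z : ι → ℝ) (f : ι → ℂ) : Prop :=
  ∃ k : ℕ, f =O[l] fun i => z i ^ k

/-- `f` decays faster than any power of the scale `z` along `l`. -/
def Negligible (l : Filter ι) (z : ι → ℝ) (f : ι → ℂ) : Prop :=
  ∀ k : ℕ, f =O[l] fun i => (z i ^ k)⁻¹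

/-- `f` is eventually nonzero and its inverse grows at most polynomially. -/
def PolyInv (l : Filter ι) (z : ι → ℝ) (f : ι → ℂ) : Prop :=
  (∀ᶠ i in l, f i ≠ 0) ∧ PolyBdd l z fun i => (f i)⁻¹

theorem pow_isBigO_pow_of_tendsto_atTop (hz : Tendsto z l atTop) {m n : ℕ} (h : m ≤ n) :
    (fun i => z i ^ m) =O[l] fun i => z i ^ n := by
  refine IsBigO.of_bound 1 ?_
  filter_upwards [hz.eventually_ge_atTop 1] with i hi
  rw [one_mul, Real.norm_of_nonneg (by positivity), Real.norm_of_nonneg (by positivity)]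
  exact pow_le_pow_right₀ hi h

theorem PolyBdd.congr (hf : PolyBdd l z f) (h : f =ᶠ[l] g) : PolyBdd l z g := by
  obtain ⟨k, hk⟩ := hf
  exact ⟨k, hk.congr' h .rfl⟩

theorem Negligible.congr (hf : Negligible l z f) (h : f =ᶠ[l] g) : Negligible l z g :=
  fun k => (hf k).congr' h .rfl

theorem PolyInv.congr (hf : PolyInv l z f) (h : f =ᶠ[l] g) : PolyInv l z g := by
  refine ⟨?_, hf.2.congr (h.mono fun i hi => by simp only [hi])⟩
  filter_upwards [hf.1, h] with i h1 h2
  rwa [← h2]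

theorem polyBdd_of_bound (C : ℝ) (h : ∀ᶠ i in l, ‖f i‖ ≤ C) : PolyBdd l z f :=
  ⟨0, IsBigO.of_bound C (by simpa using h)⟩

theorem polyBdd_of_tendsto {c : ℂ} (h : Tendsto f l (𝓝 c)) : PolyBdd l z f :=
  ⟨0, by simpa using h.isBigO_one ℝ⟩

theorem polyBdd_const (c : ℂ) : PolyBdd l z fun _ => c :=
  polyBdd_of_bound ‖c‖ (by simp)

theorem PolyBdd.add (hz : Tendsto z l atTop) (hf : PolyBdd l z f) (hg : PolyBdd l z g) :
    PolyBdd l z fun i => f i + g i := by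
  obtain ⟨m, hm⟩ := hf
  obtain ⟨n, hn⟩ := hg
  exact ⟨m + n, (hm.trans (pow_isBigO_pow_of_tendsto_atTop hz (by lia))).add
    (hn.trans (pow_isBigO_pow_of_tendsto_atTop hz (by lia)))⟩

theorem PolyBdd.mul (hf : PolyBdd l z f) (hg : PolyBdd l z g) :
    PolyBdd l z fun i => f i * g i := by
  obtain ⟨m, hm⟩ := hf
  obtain ⟨n, hn⟩ := hg
  exact ⟨m + n, by simpa only [pow_add] using hm.mul hn⟩

theorem PolyBdd.neg (hf : PolyBdd l z f) : PolyBdd l z fun i => - f i := by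
  obtain ⟨m, hm⟩ := hf
  exact ⟨m, hm.neg_left⟩

theorem PolyBdd.sub (hz : Tendsto z l atTop) (hf : PolyBdd l z f) (hg : PolyBdd l z g) :
    PolyBdd l z fun i => f i - g i := by
  simpa only [sub_eq_add_neg] using hf.add hz hg.neg

/-- A square root of a function of polynomial growth has polynomial growth. -/
theorem PolyBdd.of_sq (hz : Tendsto z l atTop) (hf : PolyBdd l z fun i => f i ^ 2) :
    PolyBdd l z f := by
  obtain ⟨m, hm⟩ := hf
  refine ⟨m, ?_⟩
  have h1 : f =O[l] fun i => (1 + ‖f i ^ 2‖ : ℝ) := by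
    refine IsBigO.of_bound 1 (Eventually.of_forall fun i => ?_)
    rw [one_mul, norm_pow, Real.norm_of_nonneg (by positivity)]
    nlinarith [sq_nonneg (‖f i‖ - 1), norm_nonneg (f i)]
  refine h1.trans (IsBigO.add ?_ hm.norm_left)
  simpa using pow_isBigO_pow_of_tendsto_atTop hz (Nat.zero_le m)

theorem Negligible.mul_polyBdd (hz : Tendsto z l atTop) (hf : Negligible l z f)
    (hg : PolyBdd l z g) : Negligible l z fun i => f i * g i := by
  obtain ⟨m, hm⟩ := hg
  intro k
  refine ((hf (k + m)).mul hm).trans (IsBigO.of_bound 1 ?_)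
  filter_upwards [hz.eventually_ge_atTop 1] with i hi
  have : z i ≠ 0 := by positivity
  rw [one_mul, pow_add, mul_inv, mul_assoc, inv_mul_cancel₀ (pow_ne_zero _ this), mul_one]

theorem PolyBdd.mul_negligible (hz : Tendsto z l atTop) (hf : PolyBdd l z f)
    (hg : Negligible l z g) : Negligible l z fun i => f i * g i := by
  simpa only [mul_comm] using hg.mul_polyBdd hz hf

theorem Negligible.add (hf : Negligible l z f) (hg : Negligible l z g) :
    Negligible l z fun i => f i + g i :=
  fun k => (hf k).add (hg k)

theorem Negligible.neg (hf : Negligible l z f) : Negligible l z fun i => - f i :=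
  fun k => (hf k).neg_left

theorem Negligible.polyBdd (hf : Negligible l z f) : PolyBdd l z f :=
  ⟨0, by simpa using hf 0⟩

theorem negligible_zero : Negligible l z fun _ => 0 :=
  fun _ => isBigO_zero _ _

theorem Negligible.tendsto_zero (hz : Tendsto z l atTop) (hf : Negligible l z f) :
    Tendsto f l (𝓝 0) := by
  refine (hf 1).trans_tendsto ?_
  simpa [Function.comp_def] using tendsto_inv_atTop_zero.comp hz

theorem PolyInv.mul (hf : PolyInv l z f) (hg : PolyInv l z g) :
    PolyInv l z fun i => f i * g i := by
  refine ⟨?_, ?_⟩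
  · filter_upwards [hf.1, hg.1] with i h1 h2 using mul_ne_zero h1 h2
  · simpa only [mul_inv] using hf.2.mul hg.2

theorem polyInv_const {c : ℂ} (hc : c ≠ 0) : PolyInv l z fun _ => c :=
  ⟨Eventually.of_forall fun _ => hc, polyBdd_const _⟩

theorem PolyInv.inv (hf : PolyBdd l z f) (h0 : ∀ᶠ i in l, f i ≠ 0) :
    PolyInv l z fun i => (f i)⁻¹ :=
  ⟨h0.mono fun _ h => inv_ne_zero h, by simpa only [inv_inv] using hf⟩

theorem polyInv_of_le_norm {c : ℝ} (hc : 0 < c) (h : ∀ᶠ i in l, c ≤ ‖f i‖) : PolyInv l z f := by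
  refine ⟨h.mono fun i hi => norm_pos_iff.1 (hc.trans_le hi), polyBdd_of_bound c⁻¹ ?_⟩
  filter_upwards [h] with i hi
  rw [norm_inv]
  gcongr

/-- If a product with a factor of polynomial growth has polynomially bounded inverse, then so has
the other factor. -/
theorem PolyInv.of_mul_left (h : PolyInv l z fun i => f i * g i) (hg : PolyBdd l z g) :
    PolyInv l z f := by
  refine ⟨h.1.mono fun i hi => left_ne_zero_of_mul hi, (h.2.mul hg).congr ?_⟩
  filter_upwards [h.1] with i hi
  have h1 := left_ne_zero_of_mul hi
  have h2 := right_ne_zero_of_mul hi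
  field_simp

/-- A negligible perturbation does not affect polynomial invertibility. -/
theorem PolyInv.add_negligible (hz : Tendsto z l atTop) (hf : PolyInv l z f)
    (hg : Negligible l z g) : PolyInv l z fun i => f i + g i := by
  have h1 : Tendsto (fun i => 1 + (f i)⁻¹ * g i) l (𝓝 1) := by
    simpa using (hf.2.mul_negligible hz hg).tendsto_zero hz |>.const_add 1
  have h2 : PolyInv l z fun i => 1 + (f i)⁻¹ * g i := by
    refine polyInv_of_le_norm (c := 1 / 2) (by norm_num) ?_
    filter_upwards [h1.norm.eventually (lt_mem_nhds (b := ‖(1 : ℂ)‖) (a := 1 / 2) (by norm_num))]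
      with i hi using hi.le
  refine (hf.mul h2).congr ?_
  filter_upwards [hf.1] with i hi
  field_simp

/-- `exp (i δ)` is negligible as soon as `Im δ` is positive and grows like a root of the scale. -/
theorem negligible_exp (hz : Tendsto z l atTop) {δ : ι → ℂ} {c : ℝ} (hc : 0 < c)
    (hpos : ∀ᶠ i in l, 0 < (δ i).im) (h : ∀ᶠ i in l, c * z i ≤ (δ i).im ^ 2) :
    Negligible l z fun i => Complex.exp (Complex.I * δ i) := by
  intro k
  refine IsBigO.of_bound ((2 * k).factorial / c ^ k) ?_
  filter_upwards [hpos, h, hz.eventually_gt_atTop 0] with i h1 h2 h3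
  have e1 : ‖Complex.exp (Complex.I * δ i)‖ = (Real.exp (δ i).im)⁻¹ := by
    rw [Complex.norm_exp, ← Real.exp_neg]
    simp
  rw [e1, norm_inv, Real.norm_of_nonneg (by positivity)]
  -- The term of order 2k of the exponential series: (Im δ)² dominates the scale, so this term
  -- dominates its k-th power.
  have h4 := Real.pow_div_factorial_le_exp (δ i).im h1.le (2 * k)
  have h5 : (c * z i) ^ k ≤ (δ i).im ^ (2 * k) := by
    rw [pow_mul]
    gcongr
  have h6 : (0 : ℝ) < (2 * k).factorial := by positivity
  calc (Real.exp (δ i).im)⁻¹ ≤ ((c * z i) ^ k / (2 * k).factorial)⁻¹ := by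
        gcongr
        exact (by gcongr : (c * z i) ^ k / ((2 * k).factorial : ℝ)
          ≤ (δ i).im ^ (2 * k) / (2 * k).factorial).trans h4
    _ = (2 * k).factorial / c ^ k * (z i ^ k)⁻¹ := by
        rw [mul_pow]; field_simp

end Asymptotic

/-! ### Characteristic matrices and attenuated waves -/

/-- The characteristic matrix of a layer with coefficient `g` and phase `δ`. -/
noncomputable def layerMatrix (g δ : ℂ) : Matrix (Fin 2) (Fin 2) ℂ :=
  !![Complex.cos δ, -Complex.I * (Complex.sin δ / g);
    -Complex.I * (g * Complex.sin δ), Complex.cos δ]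

/-- Spectral decomposition: (1, g) and (1, -g) are eigenvectors with eigenvalues exp (-iδ) and exp
(iδ). -/
theorem layerMatrix_mulVec {g : ℂ} (hg : g ≠ 0) (δ : ℂ) (v : Fin 2 → ℂ) :
    layerMatrix g δ *ᵥ v =
      (Complex.exp (-Complex.I * δ) / 2 * (v 0 + v 1 * g⁻¹)) • ![1, g]
        + (Complex.exp (Complex.I * δ) / 2 * (v 0 - v 1 * g⁻¹)) • ![1, -g] := by
  have h1 : Complex.exp (δ * Complex.I) = Complex.cos δ + Complex.sin δ * Complex.I :=
    Complex.exp_mul_I δ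
  have h2 : Complex.exp (-δ * Complex.I) = Complex.cos δ - Complex.sin δ * Complex.I := by
    rw [Complex.exp_mul_I, Complex.cos_neg, Complex.sin_neg]; ring
  rw [show Complex.I * δ = δ * Complex.I by ring, show -Complex.I * δ = -δ * Complex.I by ring,
    h1, h2]
  ext a
  fin_cases a
  · simp [layerMatrix, Matrix.mulVec, dotProduct, Fin.sum_univ_two]
    field_simp
    ring
  · simp [layerMatrix, Matrix.mulVec, dotProduct, Fin.sum_univ_two]
    field_simp
    ring

section Follows

variable {ι : Type*} {l : Filter ι} {z : ι → ℝ} {L : Prop} {v e : ι → Fin 2 → ℂ}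

/-- Up to a scalar amplitude, the vector `v` agrees with `e` with negligible error; the inverse of
the amplitude is polynomially bounded, and negligible if `L` holds. -/
def Follows (l : Filter ι) (z : ι → ℝ) (L : Prop) (v e : ι → Fin 2 → ℂ) : Prop :=
  ∃ (A : ι → ℂ) (r : ι → Fin 2 → ℂ), PolyInv l z A ∧ (L → Negligible l z fun i => (A i)⁻¹) ∧
    (∀ a, Negligible l z fun i => r i a) ∧
    ∀ᶠ i in l, ∀ a, v i a = A i * (e i a + r i a)

theorem follows_refl (v : ι → Fin 2 → ℂ) : Follows l z False v v :=
  ⟨fun _ => 1, fun _ _ => 0, polyInv_const one_ne_zero, False.elim, fun _ => negligible_zero,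
    by simp⟩

theorem Follows.mono {L' : Prop} (h : Follows l z L v e) (hL : L' → L) : Follows l z L' v e := by
  obtain ⟨A, r, h1, h2, h3⟩ := h
  exact ⟨A, r, h1, fun h => h2 (hL h), h3⟩

theorem Follows.congr {v' : ι → Fin 2 → ℂ} (h : Follows l z L v e) (hv : v =ᶠ[l] v') :
    Follows l z L v' e := by
  obtain ⟨A, r, h1, h2, h3, h4⟩ := h
  refine ⟨A, r, h1, h2, h3, ?_⟩
  filter_upwards [h4, hv] with i h5 h6
  rwa [← h6]

theorem Follows.mulVec (hz : Tendsto z l atTop) (h : Follows l z L v e)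
    {T : ι → Matrix (Fin 2) (Fin 2) ℂ} (hT : ∀ a b, PolyBdd l z fun i => T i a b) :
    Follows l z L (fun i => T i *ᵥ v i) (fun i => T i *ᵥ e i) := by
  obtain ⟨A, r, h1, h2, h3, h4⟩ := h
  refine ⟨A, fun i => T i *ᵥ r i, h1, h2, fun a => ?_, h4.mono fun i h4 a => ?_⟩
  · simpa only [Matrix.mulVec, dotProduct, Fin.sum_univ_two] using
      ((hT a 0).mul_negligible hz (h3 0)).add ((hT a 1).mul_negligible hz (h3 1))
  · simp only [Matrix.mulVec, dotProduct, Fin.sum_univ_two, h4]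
    ring

/-- A vector behind a layer in which the wave is strongly attenuated is, up to an amplitude,
the vector `(1, g)`. -/
theorem Follows.layer (hz : Tendsto z l atTop) (h : Follows l z L v e)
    (he : ∀ a, PolyBdd l z fun i => e i a) {g δ : ι → ℂ} (hg : PolyBdd l z g)
    (hg' : PolyBdd l z fun i => (g i)⁻¹) (hg0 : ∀ᶠ i in l, g i ≠ 0)
    (hδ : Negligible l z fun i => Complex.exp (Complex.I * δ i))
    (hB : PolyInv l z fun i => e i 0 + e i 1 * (g i)⁻¹) :
    Follows l z True (fun i => layerMatrix (g i) (δ i) *ᵥ v i) (fun i => ![1, g i]) := by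
  obtain ⟨A, r, h1, -, h3, h4⟩ := h
  have hρ : Negligible l z fun i => r i 0 + r i 1 * (g i)⁻¹ :=
    (h3 0).add ((h3 1).mul_polyBdd hz hg')
  have hB' := hB.add_negligible hz hρ
  have hE : ∀ i, Complex.exp (-Complex.I * δ i) = (Complex.exp (Complex.I * δ i))⁻¹ := fun i => by
    rw [neg_mul, Complex.exp_neg]
  set E : ι → ℂ := fun i => Complex.exp (Complex.I * δ i) with hEdef
  have hE0 : ∀ i, E i ≠ 0 := fun i => Complex.exp_ne_zero _
  -- Up to the factor A / 2, B and Q are the components of the incoming vector along (1, g) and (1,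
  -- -g).
  set B : ι → ℂ := fun i => (e i 0 + e i 1 * (g i)⁻¹) + (r i 0 + r i 1 * (g i)⁻¹) with hBdef
  set Q : ι → ℂ := fun i => (e i 0 + r i 0) - (e i 1 + r i 1) * (g i)⁻¹ with hQdef
  have hQ : PolyBdd l z Q :=
    ((he 0).add hz (h3 0).polyBdd).sub hz (((he 1).add hz (h3 1).polyBdd).mul hg')
  have hAinv : Negligible l z fun i => (A i * (E i)⁻¹ / 2 * B i)⁻¹ := by
    have : Negligible l z fun i => E i * ((A i)⁻¹ * (B i)⁻¹ * 2) :=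
      hδ.mul_polyBdd hz ((h1.2.mul hB'.2).mul (polyBdd_const 2))
    refine this.congr (Eventually.of_forall fun i => ?_)
    simp only [mul_inv, div_eq_mul_inv, inv_inv]
    ring
  have hsmall : Negligible l z fun i => E i * (E i * (Q i * (B i)⁻¹)) :=
    hδ.mul_polyBdd hz (hδ.polyBdd.mul (hQ.mul hB'.2))
  -- With the growing amplitude A E⁻¹ B / 2 factored out, (1, -g) keeps the coefficient E² Q / B.
  refine ⟨fun i => A i * (E i)⁻¹ / 2 * B i, fun i => (E i * (E i * (Q i * (B i)⁻¹))) • ![1, - g i],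
    ⟨?_, hAinv.polyBdd⟩, fun _ => hAinv, ?_, ?_⟩
  · filter_upwards [h1.1, hB'.1] with i hi hi'
    exact mul_ne_zero (div_ne_zero (mul_ne_zero hi (inv_ne_zero (hE0 i))) two_ne_zero) hi'
  · intro a
    fin_cases a
    · simpa using hsmall
    · simpa using (hsmall.mul_polyBdd hz hg).neg
  · filter_upwards [h4, hB'.1, hg0] with i h4 e2 e0 a
    rw [layerMatrix_mulVec e0, hE i, h4, h4]
    have e1 := hE0 i
    change (((E i)⁻¹ / 2 * (A i * (e i 0 + r i 0) + A i * (e i 1 + r i 1) * (g i)⁻¹)) • ![1, g i]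
        + (E i / 2 * (A i * (e i 0 + r i 0) - A i * (e i 1 + r i 1) * (g i)⁻¹)) • ![1, -g i]) a = _
    have e3 : A i * (e i 0 + r i 0) + A i * (e i 1 + r i 1) * (g i)⁻¹ = A i * B i := by
      simp only [hBdef]; ring
    have e4 : A i * (e i 0 + r i 0) - A i * (e i 1 + r i 1) * (g i)⁻¹ = A i * Q i := by
      simp only [hQdef]; ring
    rw [e3, e4]
    generalize B i = b at e2
    generalize Q i = q
    fin_cases a
    · simp
      field_simp
    · simp
      field_simp

/-- Reads off a linear functional of the field. The final denominator is of this form, with `L`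
recording that a strongly attenuating layer was crossed. -/
theorem Follows.contract (hz : Tendsto z l atTop) (h : Follows l z L v e) {c d : ι → ℂ}
    (hc : PolyBdd l z c) (hd : PolyBdd l z d)
    (hB : PolyInv l z fun i => c i * e i 0 + d i * e i 1) :
    PolyInv l z (fun i => c i * v i 0 + d i * v i 1) ∧
      (L → Negligible l z fun i => (c i * v i 0 + d i * v i 1)⁻¹) := by
  obtain ⟨A, r, h1, h2, h3, h4⟩ := h
  have hB' := hB.add_negligible hz ((hc.mul_negligible hz (h3 0)).add (hd.mul_negligible hz (h3 1)))
  have key : (fun i => A i * ((c i * e i 0 + d i * e i 1) + (c i * r i 0 + d i * r i 1))) =ᶠ[l]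
      fun i => c i * v i 0 + d i * v i 1 := by
    filter_upwards [h4] with i h4
    rw [h4, h4]; ring
  refine ⟨(h1.mul hB').congr key, fun hL => ((h2 hL).mul_polyBdd hz hB'.2).congr ?_⟩
  filter_upwards [key] with i hi
  rw [← hi, mul_inv]

end Follows

/-! ### Even entire functions as functions of the square -/

section EvenLift

/-- The function `h` with `h (z ^ 2) = f z`, for an even function `f`. -/
noncomputable def evenLift (f : ℂ → ℂ) (w : ℂ) : ℂ :=
  f (w ^ (1 / 2 : ℂ))

theorem cpow_half_sq (w : ℂ) : (w ^ (1 / 2 : ℂ)) ^ 2 = w := by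
  rw [one_div]
  exact Complex.cpow_nat_inv_pow w two_ne_zero

theorem evenLift_sq {f : ℂ → ℂ} (hf : ∀ z, f (-z) = f z) (z : ℂ) : evenLift f (z ^ 2) = f z := by
  rcases sq_eq_sq_iff_eq_or_eq_neg.1 (cpow_half_sq (z ^ 2)) with h | h <;>
    simp only [evenLift, h, hf]

/-- Near a nonzero point there is a holomorphic square root. -/
theorem exists_analyticAt_sq_eq {w₀ : ℂ} (hw : w₀ ≠ 0) :
    ∃ r : ℂ → ℂ, AnalyticAt ℂ r w₀ ∧ ∀ w, r w ^ 2 = w := by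
  refine ⟨fun w => w₀ ^ (1 / 2 : ℂ) * (w / w₀) ^ (1 / 2 : ℂ), ?_, fun w => ?_⟩
  · refine analyticAt_const.mul (AnalyticAt.cpow ?_ analyticAt_const ?_)
    · exact analyticAt_id.div analyticAt_const hw
    · simp [div_self hw]
  · rw [mul_pow, cpow_half_sq, cpow_half_sq, mul_div_cancel₀ _ hw]

/-- By evenness the principal root may be replaced by a local holomorphic one away from the origin;
at the origin continuity makes the singularity removable. -/
theorem analyticAt_evenLift {f : ℂ → ℂ} (hf : Differentiable ℂ f) (heven : ∀ z, f (-z) = f z)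
    (w : ℂ) : AnalyticAt ℂ (evenLift f) w := by
  have key : ∀ w₀ : ℂ, w₀ ≠ 0 → DifferentiableAt ℂ (evenLift f) w₀ := by
    intro w₀ hw
    obtain ⟨r, hr, hr2⟩ := exists_analyticAt_sq_eq hw
    have : evenLift f = fun w => f (r w) := by
      ext w
      nth_rw 1 [← hr2 w]
      exact evenLift_sq heven _
    rw [this]
    exact (hf _).comp w₀ hr.differentiableAt
  refine Complex.analyticAt_of_differentiable_on_punctured_nhds_of_continuousAt ?_ ?_
  · rcases eq_or_ne w 0 with rfl | hw
    · exact eventually_nhdsWithin_of_forall key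
    · exact eventually_nhdsWithin_of_eventually_nhds ((eventually_ne_nhds hw).mono key)
  · rcases eq_or_ne w 0 with rfl | hw
    · refine ContinuousAt.comp (f := fun w : ℂ => w ^ (1 / 2 : ℂ)) hf.continuous.continuousAt ?_
      exact Complex.continuousAt_cpow_const_of_re_pos (by simp) (by norm_num)
    · exact (key w hw).continuousAt

/-- `sin z / z`, extended by `1` at the origin. -/
noncomputable def sinQuot : ℂ → ℂ := dslope Complex.sin 0

theorem mul_sinQuot (z : ℂ) : z * sinQuot z = Complex.sin z := by
  have := sub_smul_dslope Complex.sin 0 z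
  simpa [sinQuot] using this

theorem sinQuot_neg (z : ℂ) : sinQuot (-z) = sinQuot z := by
  rcases eq_or_ne z 0 with rfl | hz
  · simp
  · have h1 := mul_sinQuot (-z)
    have h2 := mul_sinQuot z
    rw [Complex.sin_neg, ← h2] at h1
    exact mul_left_cancel₀ hz (by linear_combination -h1)

theorem differentiable_sinQuot : Differentiable ℂ sinQuot := by
  have := (Complex.differentiableOn_dslope (s := Set.univ) (c := (0 : ℂ)) univ_mem).2
    Complex.differentiable_sin.differentiableOn
  exact differentiableOn_univ.1 this

theorem norm_cos_le_exp (z : ℂ) : ‖Complex.cos z‖ ≤ Real.exp ‖z‖ := by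
  have h : ∀ w : ℂ, ‖w‖ = ‖z‖ → ‖Complex.exp w‖ ≤ Real.exp ‖z‖ := fun w hw => by
    rw [Complex.norm_exp, Real.exp_le_exp, ← hw]
    exact Complex.re_le_norm w
  rw [Complex.cos, norm_div, Complex.norm_ofNat, div_le_iff₀ two_pos]
  refine (norm_add_le _ _).trans ?_
  have h1 := h (z * Complex.I) (by simp)
  have h2 := h (-z * Complex.I) (by simp)
  linarith

theorem norm_sin_le_exp (z : ℂ) : ‖Complex.sin z‖ ≤ Real.exp ‖z‖ := by
  have h : ∀ w : ℂ, ‖w‖ = ‖z‖ → ‖Complex.exp w‖ ≤ Real.exp ‖z‖ := fun w hw => by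
    rw [Complex.norm_exp, Real.exp_le_exp, ← hw]
    exact Complex.re_le_norm w
  rw [Complex.sin, norm_div, Complex.norm_ofNat, div_le_iff₀ two_pos, norm_mul, Complex.norm_I,
    mul_one]
  refine (norm_sub_le _ _).trans ?_
  have h1 := h (z * Complex.I) (by simp)
  have h2 := h (-z * Complex.I) (by simp)
  linarith

theorem exists_norm_sinQuot_le : ∃ C : ℝ, 0 < C ∧ ∀ z, ‖sinQuot z‖ ≤ C * Real.exp ‖z‖ := by
  obtain ⟨C, hC⟩ := (isCompact_closedBall (0 : ℂ) 1).exists_bound_of_continuousOn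
    differentiable_sinQuot.continuous.continuousOn
  refine ⟨max C 1, by positivity, fun z => ?_⟩
  rcases le_total ‖z‖ 1 with hz | hz
  · refine (hC z (by simpa using hz)).trans ((le_max_left C 1).trans ?_)
    exact le_mul_of_one_le_right (by positivity) (Real.one_le_exp (norm_nonneg z))
  · have h1 : ‖sinQuot z‖ ≤ ‖Complex.sin z‖ := by
      rw [← mul_sinQuot, norm_mul]
      exact le_mul_of_one_le_left (norm_nonneg _) hz
    refine h1.trans ((norm_sin_le_exp z).trans ?_)
    exact le_mul_of_one_le_left (Real.exp_pos _).le (le_max_right C 1)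

end EvenLift

/-! ### Wolter's recursion in matrix form -/

/-- The product of the characteristic matrices of the layers `j + 1, …, j + k`. -/
noncomputable def stackMatrix (M : ℕ → Matrix (Fin 2) (Fin 2) ℂ) (j : ℕ) :
    ℕ → Matrix (Fin 2) (Fin 2) ℂ
  | 0 => 1
  | k + 1 => M (j + k + 1) * stackMatrix M j k

theorem stackMatrix_congr {M M' : ℕ → Matrix (Fin 2) (Fin 2) ℂ} {j k : ℕ}
    (h : ∀ m, j + 1 ≤ m → m ≤ j + k → M m = M' m) : stackMatrix M j k = stackMatrix M' j k := by
  induction k with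
  | zero => rfl
  | succ k ih =>
    rw [stackMatrix, stackMatrix, h _ (by lia) (by lia), ih fun m h1 h2 => h m h1 (by lia)]

/-- Sum and difference of numerator and denominator in Wolter's recursion, in terms of the
characteristic matrices. -/
theorem wolter_eq_stackMatrix (g δ : ℕ → ℂ) (k : ℕ) (hg : ∀ m, 1 ≤ m → m ≤ k → g m ≠ 0) :
    (wolter g δ k).2 + (wolter g δ k).1 = 2 ^ (k + 1) * (∏ m ∈ Finset.Icc 1 k, g m) *
        (g (k + 1) * (stackMatrix (fun m => layerMatrix (g m) (δ m)) 0 k *ᵥ ![1, g 0]) 0) ∧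
      (wolter g δ k).2 - (wolter g δ k).1 = 2 ^ (k + 1) * (∏ m ∈ Finset.Icc 1 k, g m) *
        (stackMatrix (fun m => layerMatrix (g m) (δ m)) 0 k *ᵥ ![1, g 0]) 1 := by
  induction k with
  | zero => simp [wolter, stackMatrix]; constructor <;> ring
  | succ k ih =>
    obtain ⟨h1, h2⟩ := ih fun m h1 h2 => hg m h1 (by lia)
    have hk := hg (k + 1) (by lia) le_rfl
    rw [stackMatrix, ← Matrix.mulVec_mulVec, zero_add, layerMatrix_mulVec hk,
      Finset.prod_Icc_succ_top (by lia)]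
    set V := stackMatrix (fun m => layerMatrix (g m) (δ m)) 0 k *ᵥ ![1, g 0]
    set P := ∏ m ∈ Finset.Icc 1 k, g m
    have e1 : (wolter g δ k).2 = 2 ^ k * P * (g (k + 1) * V 0 + V 1) := by
      rw [pow_succ] at h1 h2
      linear_combination (h1 + h2) / 2
    have e2 : (wolter g δ k).1 = 2 ^ k * P * (g (k + 1) * V 0 - V 1) := by
      rw [pow_succ] at h1 h2
      linear_combination (h1 - h2) / 2
    simp only [wolter, e1, e2]
    generalize Complex.exp (-Complex.I * δ (k + 1)) = x
    generalize Complex.exp (Complex.I * δ (k + 1)) = y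
    constructor
    · simp
      field_simp
      ring
    · simp
      field_simp
      ring

/-- The denominator of the reflection coefficient in terms of the characteristic matrices. -/
theorem wolter_snd_eq (g δ : ℕ → ℂ) (k : ℕ) (hg : ∀ m, 1 ≤ m → m ≤ k → g m ≠ 0) :
    (wolter g δ k).2 = 2 ^ k * (∏ m ∈ Finset.Icc 1 k, g m) *
      (g (k + 1) * (stackMatrix (fun m => layerMatrix (g m) (δ m)) 0 k *ᵥ ![1, g 0]) 0 +
        (stackMatrix (fun m => layerMatrix (g m) (δ m)) 0 k *ᵥ ![1, g 0]) 1) := by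
  obtain ⟨h1, h2⟩ := wolter_eq_stackMatrix g δ k hg
  rw [pow_succ] at h1 h2
  linear_combination (h1 + h2) / 2

/-! ### Zeros forced by growth in two opposite directions -/

section PuncturedDisc

open Metric

/-- Bound for the logarithmic derivative of a zero-free function on a disc. -/
theorem norm_deriv_div_le_of_zero_free {φ : ℂ → ℂ} {M : ℝ} (hM : 0 < M)
    (hφ : DifferentiableOn ℂ φ (ball 0 5)) (h0 : ∀ w ∈ ball (0 : ℂ) 5, φ w ≠ 0)
    (hle : ∀ w ∈ ball (0 : ℂ) 5, ‖φ w‖ ≤ Real.exp M) (h1 : 1 ≤ ‖φ 0‖) {w : ℂ} (hw : ‖w‖ ≤ 3.2) :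
    ‖deriv φ w / φ w‖ ≤ 11 * M := by
  have hd : DifferentiableOn ℂ (fun w => deriv φ w / φ w) (ball 0 5) :=
    (hφ.deriv isOpen_ball).div hφ h0
  -- ψ is the branch of log (φ / φ 0) with ψ 0 = 0; since |φ 0| ≥ 1, its real part is at most M.
  obtain ⟨ψ, hψ0, hψ⟩ := hd.isExactOn_ball.with_val_at 0 0
  have hψd : DifferentiableOn ℂ ψ (ball 0 5) := fun w hw =>
    (hψ w hw).differentiableAt.differentiableWithinAt
  have hder : ∀ w ∈ ball (0 : ℂ) 5, HasDerivAt (fun w => φ w * Complex.exp (-ψ w)) 0 w := by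
    intro w hw
    have e1 := (hφ.differentiableAt (isOpen_ball.mem_nhds hw)).hasDerivAt
    have e2 := e1.mul (hψ w hw).neg.cexp
    refine e2.congr_deriv ?_
    have := h0 w hw
    field_simp
    simp
  have hconst : ∀ w ∈ ball (0 : ℂ) 5, φ w * Complex.exp (-ψ w) = φ 0 := by
    intro w hw
    have := isOpen_ball.is_const_of_deriv_eq_zero (convex_ball (0 : ℂ) 5).isPreconnected
      (fun w hw => (hder w hw).differentiableAt.differentiableWithinAt)
      (fun w hw => (hder w hw).deriv) hw (mem_ball_self (by norm_num))
    simpa [hψ0] using this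
  have hre : Set.MapsTo ψ (ball 0 5) {z | z.re ≤ M} := by
    intro w hw
    have e : φ w = φ 0 * Complex.exp (ψ w) := by
      rw [← hconst w hw, mul_assoc, ← Complex.exp_add]; simp
    have e2 := hle w hw
    rw [e, norm_mul, Complex.norm_exp] at e2
    have : Real.exp (ψ w).re ≤ Real.exp M :=
      (le_mul_of_one_le_left (Real.exp_pos _).le h1).trans e2
    exact Real.exp_le_exp.1 this
  -- Borel–Carathéodory at radius 4.2 in the disc of radius 5 gives 2 · 4.2 M / 0.8 = 10.5 M.
  -- Cauchy's estimate on unit circles then covers |w| ≤ 3.2, which contains the segment from -iπ to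
  -- iπ.
  have hbc : ∀ u : ℂ, ‖u‖ ≤ 4.2 → ‖ψ u‖ ≤ 11 * M := by
    intro u hu
    have := Complex.borelCaratheodory_zero hM hψd hre (by norm_num)
      (show u ∈ ball (0 : ℂ) 5 by rw [mem_ball_zero_iff]; linarith) hψ0
    refine this.trans ?_
    rw [div_le_iff₀ (by linarith)]
    nlinarith [norm_nonneg u]
  have hsub : closedBall w 1 ⊆ ball (0 : ℂ) 5 := fun u hu => by
    rw [mem_ball_zero_iff]
    rw [mem_closedBall, dist_eq_norm] at hu
    have := norm_le_norm_add_norm_sub w u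
    rw [norm_sub_rev] at this
    linarith
  have hcauchy := Complex.norm_deriv_le_of_forall_mem_sphere_norm_le (c := w) (R := 1) (f := ψ)
    (C := 11 * M) one_pos ((hψd.mono hsub).diffContOnCl_ball subset_rfl) fun u hu => by
      refine hbc u ?_
      rw [mem_sphere, dist_eq_norm] at hu
      have := norm_le_norm_add_norm_sub w u
      rw [norm_sub_rev] at this
      linarith
  rw [(hψ w (hsub (mem_closedBall_self zero_le_one))).deriv] at hcauchy
  simpa using hcauchy

/-- A function which is holomorphic and zero-free in a punctured neighbourhood of the origin, of
growth `exp (O (1 / |s|))` and at least `1` on a ray, has logarithmic derivative `O (1 / |s| ^ 2)`. -/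
theorem exists_norm_sq_mul_logDeriv_le {h : ℂ → ℂ} {v : ℂ} (hv : v ≠ 0)
    (hh : ∀ᶠ s in 𝓝[≠] (0 : ℂ), DifferentiableAt ℂ h s)
    (hub : ∃ C : ℝ, ∀ᶠ s in 𝓝[≠] (0 : ℂ), ‖h s‖ ≤ Real.exp (C / ‖s‖))
    (hray : ∀ᶠ x : ℝ in 𝓝[>] 0, 1 ≤ ‖h (x * v)‖)
    (hne : ∀ᶠ s in 𝓝[≠] (0 : ℂ), h s ≠ 0) :
    ∃ K : ℝ, ∀ᶠ s in 𝓝[≠] (0 : ℂ), ‖s ^ 2 * (deriv h s / h s)‖ ≤ K := by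
  obtain ⟨C, hC⟩ := hub
  have hall := (hh.and hC).and hne
  rw [eventually_nhdsWithin_iff, Metric.eventually_nhds_iff] at hall
  obtain ⟨r, hr, hall⟩ := hall
  rw [eventually_nhdsWithin_iff, Metric.eventually_nhds_iff] at hray
  obtain ⟨r', hr', hray⟩ := hray
  have hvn : 0 < ‖v‖ := norm_pos_iff.2 hv
  refine ⟨11 * ((|C| + 1) * Real.exp 5), ?_⟩
  rw [eventually_nhdsWithin_iff, Metric.eventually_nhds_iff]
  refine ⟨min (r * Real.exp (-5)) (r' * ‖v‖), by positivity, fun s hs hs0 => ?_⟩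
  have hs0 : s ≠ 0 := hs0
  have hsn : 0 < ‖s‖ := norm_pos_iff.2 hs0
  rw [dist_zero_right, lt_min_iff] at hs
  obtain ⟨hs1, hs2⟩ := hs
  set x : ℝ := ‖s‖ / ‖v‖ with hx
  have hxpos : 0 < x := by positivity
  -- The point of the ray with the modulus of s. The chart w ↦ s₀ exp w changes moduli by at most
  -- exp 5 on |w| < 5 and reaches s at w = iθ with |θ| ≤ π.
  set s₀ : ℂ := x * v with hs₀
  have hs₀0 : s₀ ≠ 0 := mul_ne_zero (by exact_mod_cast hxpos.ne') hv
  have hs₀n : ‖s₀‖ = ‖s‖ := by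
    rw [hs₀, norm_mul, Complex.norm_real, Real.norm_of_nonneg hxpos.le, hx]
    field_simp
  have hexp : ∀ w ∈ ball (0 : ℂ) 5, ‖s‖ * Real.exp (-5) ≤ ‖s₀ * Complex.exp w‖ ∧
      ‖s₀ * Complex.exp w‖ ≤ ‖s‖ * Real.exp 5 := by
    intro w hw
    rw [mem_ball_zero_iff] at hw
    rw [norm_mul, hs₀n, Complex.norm_exp]
    have := Complex.abs_re_le_norm w
    rw [abs_le] at this
    constructor <;> gcongr <;> linarith
  have hmem : ∀ w ∈ ball (0 : ℂ) 5, (DifferentiableAt ℂ h (s₀ * Complex.exp w) ∧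
      ‖h (s₀ * Complex.exp w)‖ ≤ Real.exp (C / ‖s₀ * Complex.exp w‖)) ∧
      h (s₀ * Complex.exp w) ≠ 0 := by
    intro w hw
    refine hall ?_ (mul_ne_zero hs₀0 (Complex.exp_ne_zero w))
    rw [dist_zero_right]
    refine (hexp w hw).2.trans_lt ?_
    calc ‖s‖ * Real.exp 5 < r * Real.exp (-5) * Real.exp 5 := by gcongr
      _ = r := by rw [mul_assoc, ← Real.exp_add]; simp
  obtain ⟨θ, hθ, hsθ⟩ : ∃ θ : ℝ, |θ| ≤ Real.pi ∧ s = s₀ * Complex.exp (θ * Complex.I) := by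
    refine ⟨(s / s₀).arg, Complex.abs_arg_le_pi _, ?_⟩
    have := Complex.norm_mul_exp_arg_mul_I (s / s₀)
    rw [norm_div, hs₀n, div_self hsn.ne', Complex.ofReal_one, one_mul] at this
    rw [this, mul_div_cancel₀ _ hs₀0]
  have hθn : ‖(θ * Complex.I : ℂ)‖ ≤ 3.2 := by
    rw [norm_mul, Complex.norm_I, mul_one, Complex.norm_real]
    exact hθ.trans (by linarith [Real.pi_lt_d2])
  have hder : HasDerivAt (fun w => h (s₀ * Complex.exp w)) (deriv h s * s) (θ * Complex.I) := by
    have h1 : DifferentiableAt ℂ h (s₀ * Complex.exp (θ * Complex.I)) :=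
      (hmem _ (by rw [mem_ball_zero_iff]; linarith)).1.1
    have h2 : HasDerivAt (fun w => s₀ * Complex.exp w) (s₀ * Complex.exp (θ * Complex.I))
      (θ * Complex.I) := (Complex.hasDerivAt_exp _).const_mul s₀
    have := HasDerivAt.comp (h := fun w => s₀ * Complex.exp w) _ h1.hasDerivAt h2
    rwa [← hsθ] at this
  have key := norm_deriv_div_le_of_zero_free (φ := fun w => h (s₀ * Complex.exp w))
    (M := (|C| + 1) * Real.exp 5 / ‖s‖) (by positivity)
    (fun w hw => ((hmem w hw).1.1.comp w
      ((Complex.differentiable_exp w).const_mul s₀)).differentiableWithinAt)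
    (fun w hw => (hmem w hw).2)
    (fun w hw => by
      refine (hmem w hw).1.2.trans (Real.exp_le_exp.2 ?_)
      have h1 := (hexp w hw).1
      have h2 : 0 < ‖s‖ * Real.exp (-5) := by positivity
      calc C / ‖s₀ * Complex.exp w‖ ≤ (|C| + 1) / (‖s‖ * Real.exp (-5)) := by
            gcongr
            linarith [le_abs_self C]
        _ = (|C| + 1) * Real.exp 5 / ‖s‖ := by
            rw [Real.exp_neg]; field_simp)
    (by
      have : dist x 0 < r' := by
        rw [dist_zero_right, Real.norm_of_nonneg hxpos.le, hx, div_lt_iff₀ hvn]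
        exact hs2
      simpa [hs₀] using hray this hxpos)
    hθn
  rw [hder.deriv, ← hsθ] at key
  calc ‖s ^ 2 * (deriv h s / h s)‖ = ‖s‖ * ‖deriv h s * s / h s‖ := by
        rw [← norm_mul]; congr 1; ring
    _ ≤ ‖s‖ * (11 * ((|C| + 1) * Real.exp 5 / ‖s‖)) := by gcongr
    _ = 11 * ((|C| + 1) * Real.exp 5) := by field_simp

/-- If `|Φ'| ≤ k |Φ| / x`, then `x ^ k |Φ|` is nondecreasing. -/
theorem monotoneOn_pow_mul_normSq {Φ Φ' : ℝ → ℂ} {b : ℝ} {k : ℕ}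
    (hΦ : ∀ x ∈ Set.Ioo 0 b, HasDerivAt Φ (Φ' x) x)
    (hle : ∀ x ∈ Set.Ioo 0 b, x * ‖Φ' x‖ ≤ k * ‖Φ x‖) :
    MonotoneOn (fun x => x ^ (2 * k) * ‖Φ x‖ ^ 2) (Set.Ioo 0 b) := by
  have hd : ∀ x ∈ Set.Ioo 0 b, HasDerivAt (fun x => x ^ (2 * k) * ‖Φ x‖ ^ 2)
      ((2 * k : ℕ) * x ^ (2 * k - 1) * ‖Φ x‖ ^ 2 + x ^ (2 * k) * (2 * inner ℝ (Φ x) (Φ' x))) x :=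
    fun x hx => (hasDerivAt_pow (2 * k) x).mul (hΦ x hx).norm_sq
  refine monotoneOn_of_deriv_nonneg (convex_Ioo 0 b)
    (fun x hx => (hd x hx).continuousAt.continuousWithinAt)
    (fun x hx => (hd x (by simpa using hx)).differentiableAt.differentiableWithinAt) fun x hx => ?_
  rw [interior_Ioo] at hx
  rw [(hd x hx).deriv]
  have hx0 : 0 < x := hx.1
  have h1 := hle x hx
  have h2 : -(‖Φ x‖ * ‖Φ' x‖) ≤ inner ℝ (Φ x) (Φ' x) :=
    (abs_le.1 (abs_real_inner_le_norm (Φ x) (Φ' x))).1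
  have h3 : x * (‖Φ x‖ * ‖Φ' x‖) ≤ k * ‖Φ x‖ ^ 2 := by
    nlinarith [norm_nonneg (Φ x)]
  -- For k = 0 the power x ^ (2k - 1) is truncated and cannot be factored out, but then the bound
  -- forces Φ' = 0.
  rcases Nat.eq_zero_or_pos k with rfl | hk
  · have : ‖Φ' x‖ = 0 := by
      have : x * ‖Φ' x‖ ≤ 0 := by simpa using h1
      nlinarith [norm_nonneg (Φ' x)]
    rw [norm_eq_zero] at this
    simp [this]
  · obtain ⟨m, hm⟩ : ∃ m, 2 * k = m + 1 := ⟨2 * k - 1, by lia⟩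
    have hk2 : ((2 * k : ℕ) : ℝ) = 2 * k := by push_cast; ring
    rw [hk2, hm, Nat.add_sub_cancel, pow_succ x]
    have : 0 ≤ x ^ m * (2 * (k * ‖Φ x‖ ^ 2 + x * inner ℝ (Φ x) (Φ' x))) := by
      refine mul_nonneg (by positivity) ?_
      nlinarith
    linarith

/-- A function holomorphic in a punctured neighbourhood of `a`, of growth `exp (O (1 / |ω - a|))`,
which grows faster than any power of `1 / |ω - a|` on two opposite rays, has zeros arbitrarily
close to `a`. -/
theorem frequently_eq_zero_of_growth {H : ℂ → ℂ} {a v : ℂ} (hv : v ≠ 0)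
    (hH : ∀ᶠ ω in 𝓝[≠] a, AnalyticAt ℂ H ω)
    (hub : ∃ C : ℝ, ∀ᶠ ω in 𝓝[≠] a, ‖H ω‖ ≤ Real.exp (C / ‖ω - a‖))
    (hpos : Negligible (𝓝[>] 0) (fun x : ℝ => x⁻¹) fun x => (H (a + x * v))⁻¹)
    (hneg : Negligible (𝓝[>] 0) (fun x : ℝ => x⁻¹) fun x => (H (a + x * (-v)))⁻¹) :
    ∃ᶠ ω in 𝓝[≠] a, H ω = 0 := by
  intro hne
  have hz : Tendsto (fun x : ℝ => x⁻¹) (𝓝[>] 0) atTop := tendsto_inv_nhdsGT_zero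
  have hshift : Tendsto (fun s : ℂ => a + s) (𝓝[≠] 0) (𝓝[≠] a) := by
    refine tendsto_nhdsWithin_iff.2 ⟨?_, ?_⟩
    · refine (Continuous.tendsto' (by fun_prop) _ _ (by simp)).mono_left nhdsWithin_le_nhds
    · filter_upwards [self_mem_nhdsWithin] with s hs
      simpa using hs
  obtain ⟨h, hh⟩ : ∃ h : ℂ → ℂ, ∀ s, h s = H (a + s) := ⟨_, fun _ => rfl⟩
  simp only [← hh] at hpos hneg
  have hhd : ∀ᶠ s in 𝓝[≠] (0 : ℂ), AnalyticAt ℂ h s := by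
    filter_upwards [hshift.eventually hH] with s hs
    rw [show h = fun s => H (a + s) from funext hh]
    exact hs.comp_of_eq (analyticAt_const.add analyticAt_id) rfl
  have hne' : ∀ᶠ s in 𝓝[≠] (0 : ℂ), h s ≠ 0 := by
    simpa only [hh] using hshift.eventually hne
  have hub' : ∃ C : ℝ, ∀ᶠ s in 𝓝[≠] (0 : ℂ), ‖h s‖ ≤ Real.exp (C / ‖s‖) := by
    obtain ⟨C, hC⟩ := hub
    refine ⟨C, ?_⟩
    filter_upwards [hshift.eventually hC] with s hs
    simpa [hh] using hs
  have hline : ∀ u : ℂ, u ≠ 0 → Tendsto (fun x : ℝ => (x * u : ℂ)) (𝓝[>] 0) (𝓝[≠] 0) := by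
    intro u hu
    refine tendsto_nhdsWithin_iff.2 ⟨?_, ?_⟩
    · refine (Continuous.tendsto' (by fun_prop) _ _ (by simp)).mono_left nhdsWithin_le_nhds
    · filter_upwards [self_mem_nhdsWithin] with x hx
      have : (x : ℂ) ≠ 0 := by exact_mod_cast (ne_of_gt hx)
      exact mul_ne_zero this hu
  have hray : ∀ᶠ x : ℝ in 𝓝[>] 0, 1 ≤ ‖h (x * v)‖ := by
    have h1 := (hpos.tendsto_zero hz).norm.eventually_lt_const (u := 1) (by simp)
    filter_upwards [h1, (hline v hv).eventually hne'] with x hx hx'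
    rw [norm_inv, inv_lt_one₀ (norm_pos_iff.2 hx')] at hx
    exact hx.le
  obtain ⟨K, hK⟩ := exists_norm_sq_mul_logDeriv_le hv
    (hhd.mono fun s hs => hs.differentiableAt) hub' hray hne'
  -- Being bounded, s² h' / h has a removable singularity.
  obtain ⟨Q, hQ, hQeq⟩ : ∃ Q : ℂ → ℂ, DifferentiableAt ℂ Q 0 ∧
      ∀ᶠ s in 𝓝[≠] (0 : ℂ), Q s = s ^ 2 * (deriv h s / h s) := by
    have hall := (hhd.and hne').and hK
    have hmem : {s | (AnalyticAt ℂ h s ∧ h s ≠ 0) ∧ ‖s ^ 2 * (deriv h s / h s)‖ ≤ K} ∪ {0}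
        ∈ 𝓝 (0 : ℂ) := by
      rw [← nhdsNE_sup_pure, Filter.mem_sup]
      exact ⟨mem_of_superset hall Set.subset_union_left, by simp⟩
    obtain ⟨U, hUs, hUo, hU0⟩ := _root_.mem_nhds_iff.1 hmem
    have hU : ∀ s ∈ U \ {0}, (AnalyticAt ℂ h s ∧ h s ≠ 0) ∧ ‖s ^ 2 * (deriv h s / h s)‖ ≤ K :=
      fun s hs => (hUs hs.1).resolve_right hs.2
    refine ⟨_, (Complex.differentiableOn_update_limUnder_of_bddAbove (c := 0)
      (f := fun s => s ^ 2 * (deriv h s / h s)) (hUo.mem_nhds hU0) ?_ ?_).differentiableAt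
        (hUo.mem_nhds hU0), ?_⟩
    · intro s hs
      have := (hU s hs).1
      exact ((differentiableAt_id.pow 2).mul
        (this.1.deriv.differentiableAt.div this.1.differentiableAt this.2)).differentiableWithinAt
    · refine ⟨K, ?_⟩
      rintro _ ⟨s, hs, rfl⟩
      exact (hU s hs).2
    · filter_upwards [self_mem_nhdsWithin] with s hs
      rw [Function.update_of_ne hs]
  -- The value Q 0, which accounts for a factor exp (const / s) of h, cancels between opposite
  -- directions.
  have hQO : (fun x : ℝ => Q (x * v) - Q (x * (-v))) =O[𝓝[>] 0] fun x : ℝ => x := by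
    have h1 := hQ.isBigO_sub
    have h2 : ∀ u : ℂ, u ≠ 0 → (fun x : ℝ => Q (x * u) - Q 0) =O[𝓝[>] 0] fun x : ℝ => x := by
      intro u hu
      refine (h1.comp_tendsto ((hline u hu).mono_right nhdsWithin_le_nhds)).trans ?_
      refine IsBigO.of_bound ‖u‖ (Eventually.of_forall fun x => ?_)
      simp [mul_comm]
    simpa using (h2 v hv).sub (h2 (-v) (neg_ne_zero.2 hv))
  obtain ⟨c, hc⟩ := hQO.bound
  obtain ⟨k, hk⟩ := exists_nat_ge (c / ‖v‖)
  have hvn : 0 < ‖v‖ := norm_pos_iff.2 hv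
  have hnv : -v ≠ 0 := neg_ne_zero.2 hv
  have hev : ∀ᶠ x : ℝ in 𝓝[>] 0, HasDerivAt (fun x : ℝ => h (x * v) * h (x * (-v)))
        (deriv h (x * v) * v * h (x * (-v)) + h (x * v) * (deriv h (x * (-v)) * (-v))) x ∧
      x * ‖deriv h (x * v) * v * h (x * (-v)) + h (x * v) * (deriv h (x * (-v)) * (-v))‖ ≤
        k * ‖h (x * v) * h (x * (-v))‖ := by
    filter_upwards [(hline v hv).eventually hhd, (hline _ hnv).eventually hhd,
      (hline v hv).eventually hne', (hline _ hnv).eventually hne',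
      (hline v hv).eventually hQeq, (hline _ hnv).eventually hQeq, hc, self_mem_nhdsWithin]
      with x h1 h2 h3 h4 h5 h6 h7 hx
    have hx : 0 < x := hx
    have hxc : (x : ℂ) ≠ 0 := by exact_mod_cast hx.ne'
    have hd : ∀ u : ℂ, AnalyticAt ℂ h (x * u) →
        HasDerivAt (fun x : ℝ => h (x * u)) (deriv h (x * u) * u) x := by
      intro u hu
      have e1 : HasDerivAt (fun x : ℝ => (x * u : ℂ)) u x := by
        simpa using (Complex.ofRealCLM.hasDerivAt (x := x)).mul_const u
      exact hu.differentiableAt.hasDerivAt.comp x e1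
    refine ⟨(hd v h1).mul (hd (-v) h2), ?_⟩
    -- The two logarithmic derivatives combine to a difference of values of Q, which gains one power
    -- of x over each term.
    have e : deriv h (x * v) * v * h (x * (-v)) + h (x * v) * (deriv h (x * (-v)) * (-v)) =
        (Q (x * v) - Q (x * (-v))) / (x ^ 2 * v) * (h (x * v) * h (x * (-v))) := by
      rw [h5, h6]
      generalize h (x * v) = h₁ at h3
      generalize h (x * (-v)) = h₂ at h4
      field_simp
      ring
    rw [e, norm_mul, ← mul_assoc]
    refine mul_le_mul_of_nonneg_right ?_ (norm_nonneg _)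
    rw [norm_div, norm_mul, norm_pow, Complex.norm_real, Real.norm_of_nonneg hx.le]
    rw [Real.norm_of_nonneg hx.le] at h7
    calc x * (‖Q (x * v) - Q (x * (-v))‖ / (x ^ 2 * ‖v‖)) ≤ x * (c * x / (x ^ 2 * ‖v‖)) := by
          gcongr
      _ = c / ‖v‖ := by field_simp
      _ ≤ k := hk
  obtain ⟨b, hb, hevb⟩ := mem_nhdsGT_iff_exists_Ioo_subset.1 hev
  have hb : 0 < b := hb
  have hmono := monotoneOn_pow_mul_normSq (b := b) (k := k) (fun x hx => (hevb hx).1)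
    (fun x hx => (hevb hx).2)
  have hprod : Negligible (𝓝[>] 0) (fun x : ℝ => x⁻¹)
      fun x => (h (x * v))⁻¹ * (h (x * (-v)))⁻¹ := hpos.mul_polyBdd hz hneg.polyBdd
  obtain ⟨c', hc'⟩ := (hprod (k + 1)).bound
  set m : ℝ := (b / 2) ^ (2 * k) * ‖h (((b / 2 : ℝ) : ℂ) * v) * h (((b / 2 : ℝ) : ℂ) * (-v))‖ ^ 2
    with hm
  have hlim : Tendsto (fun x : ℝ => c' ^ 2 * x ^ 2 * m) (𝓝[>] 0) (𝓝 0) :=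
    (Continuous.tendsto' (by fun_prop) _ _ (by simp)).mono_left nhdsWithin_le_nhds
  -- Monotonicity bounds x ^ (2k) p² by its value m at b / 2, while the growth on both rays gives 1
  -- ≤ c' x ^ (k + 1) p. Squaring leaves a spare x², which tends to 0.
  have hfin : ∀ᶠ x : ℝ in 𝓝[>] 0, 1 ≤ c' ^ 2 * x ^ 2 * m := by
    filter_upwards [hc', (hline v hv).eventually hne', (hline _ hnv).eventually hne',
      Ioo_mem_nhdsGT (half_pos hb)] with x h1 h2 h3 hx
    have hx0 : 0 < x := hx.1
    have h4 := hmono (a := x) ⟨hx.1, by linarith [hx.2]⟩ (b := b / 2) ⟨by positivity, by linarith⟩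
      hx.2.le
    have h5 : x ^ (2 * k) * ‖h (x * v) * h (x * (-v))‖ ^ 2 ≤ m := h4
    set p := ‖h (x * v) * h (x * (-v))‖ with hp
    have hp0 : 0 < p := norm_pos_iff.2 (mul_ne_zero h2 h3)
    rw [← mul_inv, norm_inv, ← hp, norm_inv, norm_pow, norm_inv, Real.norm_of_nonneg hx0.le,
      inv_pow, inv_inv] at h1
    have h6 : 1 ≤ c' * x ^ (k + 1) * p := by
      rwa [inv_le_iff_one_le_mul₀ hp0] at h1
    calc (1 : ℝ) ≤ (c' * x ^ (k + 1) * p) ^ 2 := one_le_pow₀ h6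
      _ = c' ^ 2 * x ^ 2 * (x ^ (2 * k) * p ^ 2) := by ring
      _ ≤ c' ^ 2 * x ^ 2 * m := by gcongr
  have := ge_of_tendsto hlim hfin
  norm_num at this

end PuncturedDisc

/-! ### Characteristic matrices as functions of the squared index -/

/-- The coefficient `g` belonging to the refractive index `n`. -/
noncomputable def Polarization.single : Polarization → ℂ → ℂ
  | .TE, n => n
  | .TM, n => n⁻¹

theorem Polarization.coeff_eq_single (p : Polarization) (n : ℕ → ℂ) (m : ℕ) :
    p.coeff n m = p.single (n m) := by
  cases p <;> simp [Polarization.coeff, Polarization.single]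

theorem Polarization.single_ne_zero (p : Polarization) {n : ℂ} (hn : n ≠ 0) : p.single n ≠ 0 := by
  cases p
  · exact hn
  · exact inv_ne_zero hn

theorem Polarization.single_sq (p : Polarization) (n : ℂ) : p.single n ^ 2 = p.single (n ^ 2) := by
  cases p <;> simp [Polarization.single]

theorem Polarization.analyticAt_single (p : Polarization) {f : ℂ → ℂ} {x : ℂ}
    (hf : AnalyticAt ℂ f x) (h0 : f x ≠ 0) : AnalyticAt ℂ (fun z => p.single (f z)) x := by
  cases p
  · exact hf
  · exact hf.inv h0

theorem Polarization.meromorphicAt_single (p : Polarization) {f : ℂ → ℂ} {x : ℂ}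
    (hf : MeromorphicAt f x) : MeromorphicAt (fun z => p.single (f z)) x := by
  cases p
  · exact hf
  · exact hf.inv

/-- The characteristic matrix of a layer as a function of the square `w` of the refractive index
and of `κ = d ω / c`. -/
noncomputable def charMatrix (p : Polarization) (w κ : ℂ) : Matrix (Fin 2) (Fin 2) ℂ :=
  match p with
  | .TE => !![evenLift Complex.cos (w * κ ^ 2), -Complex.I * (κ * evenLift sinQuot (w * κ ^ 2));
      -Complex.I * (w * κ * evenLift sinQuot (w * κ ^ 2)), evenLift Complex.cos (w * κ ^ 2)]
  | .TM => !![evenLift Complex.cos (w * κ ^ 2), -Complex.I * (w * κ * evenLift sinQuot (w * κ ^ 2));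
      -Complex.I * (κ * evenLift sinQuot (w * κ ^ 2)), evenLift Complex.cos (w * κ ^ 2)]

/-- Both sin (n κ) / n and n sin (n κ) are even in n; the polarization only decides which of them
stands in which corner. -/
theorem charMatrix_sq (p : Polarization) {n : ℂ} (hn : n ≠ 0) (κ : ℂ) :
    charMatrix p (n ^ 2) κ = layerMatrix (p.single n) (n * κ) := by
  have h1 : evenLift Complex.cos (n ^ 2 * κ ^ 2) = Complex.cos (n * κ) := by
    rw [← mul_pow, evenLift_sq Complex.cos_neg]
  have h2 : evenLift sinQuot (n ^ 2 * κ ^ 2) = sinQuot (n * κ) := by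
    rw [← mul_pow, evenLift_sq sinQuot_neg]
  cases p
  · simp only [charMatrix, layerMatrix, h1, h2, Polarization.single, ← mul_sinQuot (n * κ)]
    congr! 4
    all_goals field_simp
  · simp only [charMatrix, layerMatrix, h1, h2, Polarization.single, ← mul_sinQuot (n * κ)]
    congr! 4
    all_goals field_simp

theorem analyticAt_charMatrix (p : Polarization) {w κ : ℂ → ℂ} {x : ℂ} (hw : AnalyticAt ℂ w x)
    (hκ : AnalyticAt ℂ κ x) (a b : Fin 2) :
    AnalyticAt ℂ (fun z => charMatrix p (w z) (κ z) a b) x := by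
  have harg : AnalyticAt ℂ (fun z => w z * κ z ^ 2) x := hw.mul (hκ.pow 2)
  have h1 : AnalyticAt ℂ (fun z => evenLift Complex.cos (w z * κ z ^ 2)) x :=
    (analyticAt_evenLift Complex.differentiable_cos Complex.cos_neg _).comp_of_eq harg rfl
  have h2 : AnalyticAt ℂ (fun z => evenLift sinQuot (w z * κ z ^ 2)) x :=
    (analyticAt_evenLift differentiable_sinQuot sinQuot_neg _).comp_of_eq harg rfl
  have h3 := analyticAt_const (v := -Complex.I) |>.mul (hκ.mul h2)
  have h4 := analyticAt_const (v := -Complex.I) |>.mul ((hw.mul hκ).mul h2)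
  cases p <;> fin_cases a <;> fin_cases b <;> first | exact h1 | exact h3 | exact h4

theorem analyticAt_stackMatrix {M : ℂ → ℕ → Matrix (Fin 2) (Fin 2) ℂ} {x : ℂ} {j k : ℕ}
    (hM : ∀ m, j + 1 ≤ m → m ≤ j + k → ∀ a b, AnalyticAt ℂ (fun z => M z m a b) x) (a b : Fin 2) :
    AnalyticAt ℂ (fun z => stackMatrix (M z) j k a b) x := by
  induction k generalizing a b with
  | zero => exact analyticAt_const
  | succ k ih =>
    have ih' := ih fun m h1 h2 => hM m h1 (by lia)
    have hm := hM (j + k + 1) (by lia) (by lia)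
    simpa [stackMatrix, Matrix.mul_apply, Fin.sum_univ_two] using
      ((hm a 0).fun_mul (ih' 0 b)).fun_add ((hm a 1).fun_mul (ih' 1 b))

theorem Set.Finite.eventually_notMem_nhdsNE {s : Set ℂ} (hs : s.Finite) (a : ℂ) :
    ∀ᶠ ω in 𝓝[≠] a, ω ∉ s := by
  have hc : IsClosed (s \ {a}) := (hs.subset Set.sdiff_subset).isClosed
  have := hc.isOpen_compl.mem_nhds (x := a) (by simp)
  rw [eventually_nhdsWithin_iff]
  filter_upwards [this] with ω h1 h2 h3
  exact h1 ⟨h3, h2⟩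

/-! ### Squared indices as rational functions and the reduced denominator -/

namespace LorentzStack

open Polynomial

variable (S : LorentzStack) (p : Polarization)

/-- `ω_j² - ω² - i Γ_j ω` as a polynomial. -/
noncomputable def lorentzPoly (j : ℕ) : ℂ[X] :=
  C ((S.charFreq j : ℂ) ^ 2) - X ^ 2 - C (Complex.I * (S.damping j : ℂ)) * X

@[simp]
theorem eval_lorentzPoly (j : ℕ) (ω : ℂ) : (S.lorentzPoly j).eval ω = S.lorentzDenom j ω := by
  simp [lorentzPoly, lorentzDenom]

/-- Denominator of the square of the refractive index of medium `m`. -/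
noncomputable def den (m : ℕ) : ℂ[X] :=
  if m = 0 ∨ m = S.N + 1 then 1 else S.lorentzPoly m

/-- Numerator of the square of the refractive index of medium `m`. -/
noncomputable def num (m : ℕ) : ℂ[X] :=
  if m = 0 then C ((S.nIn : ℂ) ^ 2) else if m = S.N + 1 then C ((S.nOut : ℂ) ^ 2)
  else S.lorentzPoly m + C (S.strength m : ℂ)

/-- The square of the refractive index of medium `m`. -/
noncomputable def indexSq (m : ℕ) (ω : ℂ) : ℂ :=
  (S.num m).eval ω / (S.den m).eval ω

theorem den_layer {m : ℕ} (h1 : 1 ≤ m) (h2 : m ≤ S.N) (ω : ℂ) :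
    (S.den m).eval ω = S.lorentzDenom m ω := by
  rw [den, if_neg (by lia), eval_lorentzPoly]

theorem num_layer {m : ℕ} (h1 : 1 ≤ m) (h2 : m ≤ S.N) (ω : ℂ) :
    (S.num m).eval ω = S.lorentzDenom m ω + S.strength m := by
  rw [num, if_neg (by lia), if_neg (by lia), eval_add, eval_lorentzPoly, eval_C]

theorem indexSq_zero (ω : ℂ) : S.indexSq 0 ω = (S.nIn : ℂ) ^ 2 := by
  simp [indexSq, num, den]

theorem indexSq_last (ω : ℂ) : S.indexSq (S.N + 1) ω = (S.nOut : ℂ) ^ 2 := by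
  simp [indexSq, num, den]

theorem indexSq_layer {m : ℕ} (h1 : 1 ≤ m) (h2 : m ≤ S.N) {ω : ℂ}
    (h : S.lorentzDenom m ω ≠ 0) :
    S.indexSq m ω = 1 + (S.strength m : ℂ) / S.lorentzDenom m ω := by
  rw [indexSq, S.den_layer h1 h2, S.num_layer h1 h2, add_div, div_self h]

theorem meromorphicAt_indexSq (m : ℕ) (ω : ℂ) : MeromorphicAt (S.indexSq m) ω := by
  have h : ∀ q : ℂ[X], AnalyticAt ℂ (fun z => q.eval z) ω := fun q => by
    simpa using AnalyticAt.aeval_polynomial (analyticAt_id (𝕜 := ℂ) (z := ω)) q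
  exact (h _).meromorphicAt.div (h _).meromorphicAt

theorem analyticAt_indexSq {m : ℕ} {ω : ℂ} (h : (S.den m).eval ω ≠ 0) :
    AnalyticAt ℂ (S.indexSq m) ω := by
  have h' : ∀ q : ℂ[X], AnalyticAt ℂ (fun z => q.eval z) ω := fun q => by
    simpa using AnalyticAt.aeval_polynomial (analyticAt_id (𝕜 := ℂ) (z := ω)) q
  exact (h' _).div (h' _) h

/-- The characteristic matrix of layer `m` at frequency `ω`. -/
noncomputable def layerChar (ω : ℂ) (m : ℕ) : Matrix (Fin 2) (Fin 2) ℂ :=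
  charMatrix p (S.indexSq m ω) (S.thickness m * ω / S.c)

theorem analyticAt_layerChar {m : ℕ} {ω : ℂ} (h : (S.den m).eval ω ≠ 0) (a b : Fin 2) :
    AnalyticAt ℂ (fun z => S.layerChar p z m a b) ω :=
  analyticAt_charMatrix p (S.analyticAt_indexSq h)
    ((analyticAt_const.mul analyticAt_id).div analyticAt_const
      (by exact_mod_cast S.c_pos.ne')) a b

theorem layerChar_eq {m : ℕ} {ω n : ℂ} (hn : n ≠ 0) (hw : n ^ 2 = S.indexSq m ω) :
    S.layerChar p ω m = layerMatrix (p.single n) (n * (S.thickness m * ω / S.c)) := by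
  rw [layerChar, ← hw, charMatrix_sq p hn]

/-- The field behind the last layer, for an outgoing wave in medium `0`. -/
noncomputable def outField (ω : ℂ) : Fin 2 → ℂ :=
  stackMatrix (S.layerChar p ω) 0 S.N *ᵥ ![1, p.single S.nIn]

/-- The denominator, freed from the factors which depend on the choice of the roots `n_j`. -/
noncomputable def reducedDenom (ω : ℂ) : ℂ :=
  p.single S.nOut * S.outField p ω 0 + S.outField p ω 1

/-- The product of the coefficients carries all the dependence on the choice of roots; no other
factor vanishes off the zeros and poles of the squared indices except `reducedDenom`. -/
theorem denominator_eq {ω : ℂ} {n : ℕ → ℂ} (hn : S.IsIndexAt ω n)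
    (h : ∀ m, 1 ≤ m → m ≤ S.N → (S.den m).eval ω ≠ 0 ∧ (S.num m).eval ω ≠ 0) :
    (∀ m, 1 ≤ m → m ≤ S.N → n m ≠ 0 ∧ n m ^ 2 = S.indexSq m ω) ∧
    S.denominator p ω n =
      2 ^ S.N * (∏ m ∈ Finset.Icc 1 S.N, p.single (n m)) * S.reducedDenom p ω := by
  have hsq : ∀ m, 1 ≤ m → m ≤ S.N → n m ≠ 0 ∧ n m ^ 2 = S.indexSq m ω := by
    intro m h1 h2
    have hd := (h m h1 h2).1
    have hd' := hd
    rw [S.den_layer h1 h2] at hd'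
    have e : n m ^ 2 = S.indexSq m ω := by
      rw [S.indexSq_layer h1 h2 hd', hn.layer m h1 h2 hd']
    refine ⟨fun h0 => ?_, e⟩
    rw [h0, indexSq, zero_pow two_ne_zero, eq_comm, div_eq_zero_iff] at e
    exact e.elim (h m h1 h2).2 hd
  refine ⟨hsq, ?_⟩
  rw [denominator, wolter_snd_eq _ _ _ fun m h1 h2 => by
    rw [p.coeff_eq_single]; exact p.single_ne_zero (hsq m h1 h2).1]
  simp only [p.coeff_eq_single, hn.left, hn.right]
  rw [stackMatrix_congr (M' := S.layerChar p ω) fun m h1 h2 => ?_]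
  · rfl
  · have := hsq m (by lia) (by lia)
    rw [S.layerChar_eq p this.1 this.2, phase]
    congr 1
    ring

theorem denominator_sq_eq {ω : ℂ} {n : ℕ → ℂ} (hn : S.IsIndexAt ω n)
    (h : ∀ m, 1 ≤ m → m ≤ S.N → (S.den m).eval ω ≠ 0 ∧ (S.num m).eval ω ≠ 0) :
    S.denominator p ω n ^ 2 =
      4 ^ S.N * (∏ m ∈ Finset.Icc 1 S.N, p.single (S.indexSq m ω)) * S.reducedDenom p ω ^ 2 := by
  obtain ⟨h1, h2⟩ := S.denominator_eq p hn h
  rw [h2, mul_pow, mul_pow, ← pow_mul, mul_comm S.N 2, pow_mul, ← Finset.prod_pow]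
  norm_num
  left
  refine Finset.prod_congr rfl fun m hm => ?_
  rw [Finset.mem_Icc] at hm
  rw [p.single_sq, (h1 m hm.1 hm.2).2]

theorem analyticAt_reducedDenom {ω : ℂ} (h : ∀ m, 1 ≤ m → m ≤ S.N → (S.den m).eval ω ≠ 0) :
    AnalyticAt ℂ (S.reducedDenom p) ω := by
  have hA : ∀ a b, AnalyticAt ℂ (fun z => stackMatrix (S.layerChar p z) 0 S.N a b) ω :=
    fun a b => analyticAt_stackMatrix (M := S.layerChar p)
      (fun m h1 h2 => S.analyticAt_layerChar p (h m (by lia) (by lia))) a b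
  have hv : ∀ a, AnalyticAt ℂ (fun z => S.outField p z a) ω := fun a => by
    simpa [outField, Matrix.mulVec, dotProduct, Fin.sum_univ_two] using
      (hA a 0).fun_add ((hA a 1).fun_mul analyticAt_const)
  exact (analyticAt_const.mul (hv 0)).add (hv 1)

/-- In a layer, numerator and denominator differ by the oscillator strength, which is positive; so
every zero of the denominator is a genuine pole of the squared index. -/
theorem num_ne_zero_of_den_eq_zero {m : ℕ} {b : ℂ} (hm : m ≤ S.N + 1)
    (h : (S.den m).eval b = 0) : 1 ≤ m ∧ m ≤ S.N ∧ (S.num m).eval b ≠ 0 := by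
  by_cases h0 : m = 0 ∨ m = S.N + 1
  · rw [den, if_pos h0] at h
    simp at h
  · have h1 : 1 ≤ m := by lia
    have h2 : m ≤ S.N := by lia
    refine ⟨h1, h2, ?_⟩
    rw [S.den_layer h1 h2] at h
    rw [S.num_layer h1 h2, h, zero_add]
    exact_mod_cast (S.strength_pos m h1 h2).ne'

/-- On the positive imaginary axis numerator and denominator of the squared index are positive. -/
theorem exists_pos_eval_imaginary {m : ℕ} (hm : m ≤ S.N + 1) {y : ℝ} (hy : 0 < y) :
    ∃ r s : ℝ, 0 < r ∧ 0 < s ∧ (S.num m).eval (y * Complex.I) = r ∧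
      (S.den m).eval (y * Complex.I) = s ∧ (1 ≤ m → m ≤ S.N → s ≤ r) := by
  by_cases h0 : m = 0
  · subst h0
    exact ⟨S.nIn ^ 2, 1, pow_pos S.nIn_pos 2, one_pos, by simp [num], by simp [den], by lia⟩
  by_cases hN : m = S.N + 1
  · subst hN
    exact ⟨S.nOut ^ 2, 1, pow_pos S.nOut_pos 2, one_pos, by simp [num], by simp [den], by lia⟩
  have h1 : 1 ≤ m := by lia
  have h2 : m ≤ S.N := by lia
  have e : S.lorentzDenom m (y * Complex.I) =
      ((S.charFreq m ^ 2 + y ^ 2 + S.damping m * y : ℝ) : ℂ) := by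
    rw [lorentzDenom]
    push_cast
    linear_combination (-(y : ℂ) ^ 2 - (S.damping m : ℂ) * y) * Complex.I_sq
  have hω := S.charFreq_pos m h1 h2
  have hΓ := S.damping_nonneg m h1 h2
  have hf := S.strength_pos m h1 h2
  refine ⟨S.charFreq m ^ 2 + y ^ 2 + S.damping m * y + S.strength m,
    S.charFreq m ^ 2 + y ^ 2 + S.damping m * y, by positivity, by positivity, ?_, ?_, ?_⟩
  · rw [S.num_layer h1 h2, e]; push_cast; ring
  · rw [S.den_layer h1 h2, e]
  · intros; linarith

theorem den_ne_zero {m : ℕ} (hm : m ≤ S.N + 1) : S.den m ≠ 0 := by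
  obtain ⟨r, s, hr, hs, -, h, -⟩ := S.exists_pos_eval_imaginary hm one_pos
  intro h0
  rw [h0, eval_zero, eq_comm] at h
  exact hs.ne' (by exact_mod_cast h)

theorem num_ne_zero {m : ℕ} (hm : m ≤ S.N + 1) : S.num m ≠ 0 := by
  obtain ⟨r, s, hr, hs, h, -, -⟩ := S.exists_pos_eval_imaginary hm one_pos
  intro h0
  rw [h0, eval_zero, eq_comm] at h
  exact hr.ne' (by exact_mod_cast h)

/-- The finite set of zeros and poles of the squared indices. -/
noncomputable def exceptional : Finset ℂ :=
  (∏ m ∈ Finset.range (S.N + 2), S.num m * S.den m).roots.toFinset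

theorem not_mem_exceptional {ω : ℂ} :
    ω ∉ S.exceptional ↔ ∀ m, m ≤ S.N + 1 → (S.num m).eval ω ≠ 0 ∧ (S.den m).eval ω ≠ 0 := by
  have h0 : ∏ m ∈ Finset.range (S.N + 2), S.num m * S.den m ≠ 0 :=
    Finset.prod_ne_zero_iff.2 fun m hm => by
      rw [Finset.mem_range] at hm
      exact mul_ne_zero (S.num_ne_zero (by lia)) (S.den_ne_zero (by lia))
  rw [exceptional, Multiset.mem_toFinset, mem_roots h0, IsRoot.def, eval_prod,
    Finset.prod_eq_zero_iff]
  constructor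
  · intro h m hm
    by_contra hc
    refine h ⟨m, by rw [Finset.mem_range]; lia, ?_⟩
    rw [eval_mul, mul_eq_zero]
    tauto
  · rintro h ⟨m, hm, he⟩
    rw [Finset.mem_range] at hm
    rw [eval_mul, mul_eq_zero] at he
    exact he.elim (h m (by lia)).1 (h m (by lia)).2

theorem eventually_not_mem_exceptional (a : ℂ) : ∀ᶠ ω in 𝓝[≠] a, ω ∉ S.exceptional :=
  S.exceptional.finite_toSet.eventually_notMem_nhdsNE a

end LorentzStack

/-! ### Growth of polynomials on the imaginary axis and of meromorphic functions on rays -/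

theorem Polynomial.polyBdd_eval_imaginary (q : Polynomial ℂ) :
    PolyBdd atTop (fun y : ℝ => y) fun y : ℝ => q.eval (y * Complex.I) := by
  have hz : Tendsto (fun y : ℝ => y) atTop atTop := tendsto_id
  have hX : PolyBdd atTop (fun y : ℝ => y) fun y : ℝ => (y * Complex.I : ℂ) := by
    refine ⟨1, IsBigO.of_bound 1 (Eventually.of_forall fun y => ?_)⟩
    simp
  induction q using Polynomial.induction_on' with
  | add q r hq hr => simpa using hq.add hz hr
  | monomial n c =>
    simp only [Polynomial.eval_monomial]
    refine (polyBdd_const c).mul ?_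
    induction n with
    | zero => simpa using polyBdd_const 1
    | succ n ih => simpa only [pow_succ] using ih.mul hX

theorem Polynomial.polyInv_eval_imaginary {q : Polynomial ℂ} (hq : q ≠ 0) :
    PolyInv atTop (fun y : ℝ => y) fun y : ℝ => q.eval (y * Complex.I) := by
  rcases le_or_gt q.degree 0 with hd | hd
  · rw [Polynomial.eq_C_of_degree_le_zero hd] at hq ⊢
    simp only [Polynomial.eval_C]
    exact polyInv_const fun h => hq (by rw [h, Polynomial.C_0])
  · have h1 : Tendsto (fun y : ℝ => ‖(y * Complex.I : ℂ)‖) atTop atTop := by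
      simpa using tendsto_abs_atTop_atTop
    have h2 := Polynomial.tendsto_norm_atTop q hd h1
    exact polyInv_of_le_norm one_pos (h2.eventually_ge_atTop 1)

section Ray

variable {f : ℂ → ℂ} {a v : ℂ}

theorem tendsto_inv_scale : Tendsto (fun x : ℝ => x⁻¹) (𝓝[>] 0) atTop := tendsto_inv_nhdsGT_zero

theorem tendsto_ray (hv : v ≠ 0) : Tendsto (fun x : ℝ => a + x * v) (𝓝[>] 0) (𝓝[≠] a) := by
  refine tendsto_nhdsWithin_iff.2 ⟨?_, ?_⟩
  · refine (Continuous.tendsto' (by fun_prop) _ _ (by simp)).mono_left nhdsWithin_le_nhds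
  · filter_upwards [self_mem_nhdsWithin] with x hx
    have : (x : ℂ) ≠ 0 := by exact_mod_cast (ne_of_gt hx)
    simpa [hv] using (ne_of_gt hx)

/-- A meromorphic function grows at most polynomially along a ray. -/
theorem MeromorphicAt.polyBdd_ray (hf : MeromorphicAt f a) (hv : v ≠ 0) :
    PolyBdd (𝓝[>] 0) (fun x : ℝ => x⁻¹) fun x : ℝ => f (a + x * v) := by
  obtain ⟨n, hn⟩ := hf
  have h1 : PolyBdd (𝓝[>] 0) (fun x : ℝ => x⁻¹)
      fun x : ℝ => ((a + x * v) - a) ^ n • f (a + x * v) :=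
    polyBdd_of_tendsto (hn.continuousAt.tendsto.comp
      ((tendsto_ray hv).mono_right nhdsWithin_le_nhds))
  have h2 : PolyBdd (𝓝[>] 0) (fun x : ℝ => x⁻¹) fun x : ℝ => ((x : ℂ) * v)⁻¹ ^ n := by
    refine ⟨n, IsBigO.of_bound (‖v‖⁻¹ ^ n) (Eventually.of_forall fun x => ?_)⟩
    simp only [norm_pow, norm_inv, norm_mul, Complex.norm_real, mul_inv, mul_pow]
    rw [mul_comm]
  refine (h2.mul h1).congr ?_
  filter_upwards [self_mem_nhdsWithin] with x hx
  have : (x : ℂ) ≠ 0 := by exact_mod_cast (ne_of_gt hx)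
  rw [add_sub_cancel_left, smul_eq_mul, ← mul_assoc, ← mul_pow,
    inv_mul_cancel₀ (mul_ne_zero this hv), one_pow, one_mul]

/-- A meromorphic function which does not vanish identically is polynomially invertible along
a ray. -/
theorem MeromorphicAt.polyInv_ray (hf : MeromorphicAt f a) (hv : v ≠ 0)
    (h0 : ¬ ∀ᶠ z in 𝓝[≠] a, f z = 0) :
    PolyInv (𝓝[>] 0) (fun x : ℝ => x⁻¹) fun x : ℝ => f (a + x * v) :=
  ⟨(tendsto_ray hv).eventually (hf.eventually_eq_zero_or_eventually_ne_zero.resolve_left h0),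
    hf.inv.polyBdd_ray hv⟩

end Ray

/-! ### Interface factors and their sign products -/

/-- The product of `v 0 ± v 1 * h` over both signs of `h` and of `g`, with `v = M (1, ± g)`,
as a function of `G = g²` and `L = h²`. -/
def signProd (G L : ℂ) (M : Matrix (Fin 2) (Fin 2) ℂ) : ℂ :=
  (M 0 0 ^ 2 + L * M 1 0 ^ 2 - G * M 0 1 ^ 2 - G * L * M 1 1 ^ 2) ^ 2 -
    4 * L * (M 0 0 * M 1 0 - G * M 0 1 * M 1 1) ^ 2

/-- The interface factor between the vector `M (1, g)` and a medium with coefficient `1 / h`. -/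
def interfaceFactor (M : Matrix (Fin 2) (Fin 2) ℂ) (g h : ℂ) : ℂ :=
  (M *ᵥ ![1, g]) 0 + (M *ᵥ ![1, g]) 1 * h

/-- The product of all conjugates under g ↦ -g and h ↦ -h involves only g² and h², and so frees the
interface factor from the choice of roots. -/
theorem signProd_sq (g h : ℂ) (M : Matrix (Fin 2) (Fin 2) ℂ) :
    signProd (g ^ 2) (h ^ 2) M = interfaceFactor M g h *
      (interfaceFactor M (-g) h * (interfaceFactor M g (-h) * interfaceFactor M (-g) (-h))) := by
  simp [signProd, interfaceFactor, Matrix.mulVec, dotProduct, Fin.sum_univ_two]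
  ring

namespace LorentzStack

open Polynomial

variable (S : LorentzStack) (p : Polarization)

/-- The squared indices of the media `j` and `k` are different rational functions. -/
def Distinct (j k : ℕ) : Prop :=
  S.num j * S.den k - S.num k * S.den j ≠ 0

/-- The point b is a pole of one squared index and not of the other. -/
theorem distinct_of_den_eq_zero {j k : ℕ} {b : ℂ} (hj : j ≤ S.N + 1)
    (h1 : (S.den j).eval b = 0) (h2 : (S.den k).eval b ≠ 0) : S.Distinct j k := by
  intro h
  have h3 := congrArg (eval b) h
  rw [eval_sub, eval_mul, eval_mul, h1, mul_zero, sub_zero, eval_zero, mul_eq_zero] at h3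
  exact h3.elim (S.num_ne_zero_of_den_eq_zero hj h1).2.2 h2

theorem Distinct.symm {j k : ℕ} (h : S.Distinct j k) : S.Distinct k j := by
  intro h'
  refine h ?_
  linear_combination -h'

/-- A layer is different from a half-space. -/
theorem distinct_layer_halfSpace {j k : ℕ} (h1 : 1 ≤ j) (h2 : j ≤ S.N)
    (hk : k = 0 ∨ k = S.N + 1) : S.Distinct j k := by
  obtain ⟨b, hb⟩ := IsAlgClosed.exists_root (S.lorentzPoly j) (by
    have : (S.lorentzPoly j).degree = 2 := by
      rw [lorentzPoly]
      compute_degree!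
    rw [this]
    norm_num)
  refine S.distinct_of_den_eq_zero (b := b) (by lia) ?_ ?_
  · rw [S.den_layer h1 h2, ← eval_lorentzPoly]
    exact hb
  · rw [den, if_pos hk]
    simp

/-- The positive root of the squared index on the imaginary axis. -/
noncomputable def posIndex (m : ℕ) (y : ℝ) : ℝ :=
  √(S.indexSq m (y * Complex.I)).re

theorem posIndex_spec {m : ℕ} (hm : m ≤ S.N + 1) {y : ℝ} (hy : 0 < y) :
    0 < S.posIndex m y ∧ (S.posIndex m y : ℂ) ^ 2 = S.indexSq m (y * Complex.I) ∧
      (1 ≤ m → m ≤ S.N → 1 ≤ S.posIndex m y) := by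
  obtain ⟨r, s, hr, hs, h1, h2, h3⟩ := S.exists_pos_eval_imaginary hm hy
  have e : S.indexSq m (y * Complex.I) = ((r / s : ℝ) : ℂ) := by
    rw [indexSq, h1, h2]; push_cast; rfl
  have e2 : S.posIndex m y = √(r / s) := by rw [posIndex, e, Complex.ofReal_re]
  refine ⟨by rw [e2]; positivity, ?_, fun h4 h5 => ?_⟩
  · rw [e2, e, ← Complex.ofReal_pow, Real.sq_sqrt (by positivity)]
  · rw [e2]
    refine Real.le_sqrt_of_sq_le ?_
    rw [one_pow, le_div_iff₀ hs, one_mul]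
    exact h3 h4 h5

theorem _root_.Polarization.exists_single_real (p : Polarization) {x : ℝ} (hx : 0 < x) :
    ∃ r : ℝ, 0 < r ∧ p.single x = r := by
  cases p
  · exact ⟨x, hx, rfl⟩
  · exact ⟨x⁻¹, inv_pos.2 hx, by simp [Polarization.single]⟩

theorem eventually_posIndex_sq {m : ℕ} (hm : m ≤ S.N + 1) :
    ∀ᶠ y : ℝ in atTop, p.single (S.posIndex m y) ^ 2 = p.single (S.indexSq m (y * Complex.I)) := by
  filter_upwards [eventually_gt_atTop 0] with y hy
  rw [p.single_sq, (S.posIndex_spec hm hy).2.1]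

theorem polyBdd_single_indexSq_imaginary {m : ℕ} (hm : m ≤ S.N + 1) :
    PolyBdd atTop (fun y : ℝ => y) (fun y : ℝ => p.single (S.indexSq m (y * Complex.I))) ∧
      PolyBdd atTop (fun y : ℝ => y) fun y : ℝ => (p.single (S.indexSq m (y * Complex.I)))⁻¹ := by
  have h1 := (S.num m).polyBdd_eval_imaginary.mul (polyInv_eval_imaginary (S.den_ne_zero hm)).2
  have h2 := (S.den m).polyBdd_eval_imaginary.mul (polyInv_eval_imaginary (S.num_ne_zero hm)).2
  cases p
  · simp only [Polarization.single, indexSq, inv_div]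
    exact ⟨h1, h2⟩
  · simp only [Polarization.single, indexSq, inv_div]
    exact ⟨h2, h1⟩

theorem polyBdd_single_posIndex {m : ℕ} (hm : m ≤ S.N + 1) :
    PolyBdd atTop (fun y : ℝ => y) (fun y : ℝ => p.single (S.posIndex m y)) ∧
      PolyBdd atTop (fun y : ℝ => y) fun y : ℝ => (p.single (S.posIndex m y))⁻¹ := by
  obtain ⟨h1, h2⟩ := S.polyBdd_single_indexSq_imaginary p hm
  have h3 := S.eventually_posIndex_sq p hm
  constructor
  · refine PolyBdd.of_sq tendsto_id (h1.congr ?_)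
    filter_upwards [h3] with y hy using hy.symm
  · refine PolyBdd.of_sq tendsto_id (h2.congr ?_)
    filter_upwards [h3] with y hy
    rw [inv_pow, hy]

/-- Both coefficients are positive reals, so nothing can cancel, even between equal media. -/
theorem polyInv_one_add_posIndex {j k : ℕ} (hj : j ≤ S.N + 1) (hk : k ≤ S.N + 1) :
    PolyInv atTop (fun y : ℝ => y)
      fun y : ℝ => 1 + p.single (S.posIndex j y) * (p.single (S.posIndex k y))⁻¹ := by
  refine polyInv_of_le_norm one_pos ?_
  filter_upwards [eventually_gt_atTop 0] with y hy
  obtain ⟨r, hr, e1⟩ := p.exists_single_real (S.posIndex_spec hj hy).1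
  obtain ⟨s, hs, e2⟩ := p.exists_single_real (S.posIndex_spec hk hy).1
  have e3 : 1 + p.single (S.posIndex j y) * (p.single (S.posIndex k y))⁻¹ =
      ((1 + r * s⁻¹ : ℝ) : ℂ) := by
    rw [e1, e2]; push_cast; rfl
  rw [e3, Complex.norm_real, Real.norm_of_nonneg (by positivity)]
  have : 0 < r * s⁻¹ := by positivity
  linarith

/-- The interface factor of two different media on the imaginary axis, for both signs. -/
theorem Distinct.polyInv_one_add {j k : ℕ} (h : S.Distinct j k) (hj : j ≤ S.N + 1)
    (hk : k ≤ S.N + 1) {σ : ℂ} (hσ : σ ^ 2 = 1) :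
    PolyInv atTop (fun y : ℝ => y)
      fun y : ℝ => 1 + σ * p.single (S.posIndex j y) * (p.single (S.posIndex k y))⁻¹ := by
  have hz : Tendsto (fun y : ℝ => y) atTop atTop := tendsto_id
  have hg := (S.polyBdd_single_posIndex p hj).1
  have hh := (S.polyBdd_single_posIndex p hk).2
  -- Multiplying by the conjugate factor gives 1 minus the quotient of the squared coefficients, a
  -- rational function that is not identically zero because the media are distinct.
  refine PolyInv.of_mul_left
    (g := fun y : ℝ => 1 - σ * p.single (S.posIndex j y) * (p.single (S.posIndex k y))⁻¹) ?_
    ((polyBdd_const 1).sub hz (((polyBdd_const σ).mul hg).mul hh))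
  have hd : PolyInv atTop (fun y : ℝ => y)
      fun y : ℝ => 1 - p.single (S.indexSq j (y * Complex.I)) *
        (p.single (S.indexSq k (y * Complex.I)))⁻¹ := by
    have hnd : ∀ y : ℝ, 0 < y → ∀ m, m ≤ S.N + 1 → (S.num m).eval (y * Complex.I) ≠ 0 ∧
        (S.den m).eval (y * Complex.I) ≠ 0 := by
      intro y hy m hm
      obtain ⟨r, s, hr, hs, h1, h2, -⟩ := S.exists_pos_eval_imaginary hm hy
      rw [h1, h2]
      exact ⟨by exact_mod_cast hr.ne', by exact_mod_cast hs.ne'⟩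
    cases p
    · refine ((polyInv_eval_imaginary h.symm).mul (PolyInv.inv
        (S.den j * S.num k).polyBdd_eval_imaginary ?_)).congr ?_
      · filter_upwards [eventually_gt_atTop 0] with y hy
        rw [eval_mul]
        exact mul_ne_zero (hnd y hy j hj).2 (hnd y hy k hk).1
      · filter_upwards [eventually_gt_atTop 0] with y hy
        have h1 := hnd y hy j hj
        have h2 := hnd y hy k hk
        have := h1.2
        have := h2.1
        simp only [eval_sub, eval_mul, Polarization.single, indexSq]
        field_simp
    · refine ((polyInv_eval_imaginary h).mul (PolyInv.inv
        (S.num j * S.den k).polyBdd_eval_imaginary ?_)).congr ?_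
      · filter_upwards [eventually_gt_atTop 0] with y hy
        rw [eval_mul]
        exact mul_ne_zero (hnd y hy j hj).1 (hnd y hy k hk).2
      · filter_upwards [eventually_gt_atTop 0] with y hy
        have h1 := hnd y hy j hj
        have h2 := hnd y hy k hk
        have := h1.1
        have := h2.2
        simp only [eval_sub, eval_mul, Polarization.single, indexSq]
        field_simp
  refine hd.congr ?_
  filter_upwards [S.eventually_posIndex_sq p hj, S.eventually_posIndex_sq p hk] with y h1 h2
  rw [← h1, ← h2]
  linear_combination (p.single (S.posIndex j y)) ^ 2 * ((p.single (S.posIndex k y))⁻¹) ^ 2 * hσ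

/-- On the imaginary axis every layer attenuates. -/
theorem negligible_exp_imaginary {m : ℕ} (h1 : 1 ≤ m) (h2 : m ≤ S.N) :
    Negligible atTop (fun y : ℝ => y) fun y : ℝ => Complex.exp (Complex.I *
      ((S.posIndex m y : ℂ) * (S.thickness m * (y * Complex.I) / S.c))) := by
  have hd := S.thickness_pos m h1 h2
  have hc := S.c_pos
  have him : ∀ y : ℝ, ((S.posIndex m y : ℂ) * (S.thickness m * (y * Complex.I) / S.c)).im =
      S.posIndex m y * (S.thickness m * y / S.c) := by
    intro y
    have : (S.posIndex m y : ℂ) * (S.thickness m * (y * Complex.I) / S.c) =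
      ((S.posIndex m y * (S.thickness m * y / S.c) : ℝ) : ℂ) * Complex.I := by
      push_cast; ring
    rw [this]; simp
  refine negligible_exp tendsto_id (c := (S.thickness m / S.c) ^ 2) (by positivity) ?_ ?_
  · filter_upwards [eventually_gt_atTop 0] with y hy
    rw [him]
    have := (S.posIndex_spec (by lia : m ≤ S.N + 1) hy).1
    positivity
  · filter_upwards [eventually_ge_atTop 1] with y hy
    rw [him, mul_pow]
    have h3 := (S.posIndex_spec (by lia : m ≤ S.N + 1) (by linarith : 0 < y)).2.2 h1 h2
    have h4 : 1 ≤ S.posIndex m y ^ 2 := one_le_pow₀ h3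
    have h5 : y ≤ y ^ 2 := by nlinarith
    calc (S.thickness m / S.c) ^ 2 * y ≤ (S.thickness m / S.c) ^ 2 * y ^ 2 := by gcongr
      _ = 1 * (S.thickness m * y / S.c) ^ 2 := by ring
      _ ≤ S.posIndex m y ^ 2 * (S.thickness m * y / S.c) ^ 2 := by gcongr

/-- On the imaginary axis, far from the origin, the wave behind the layers `j + 1, …, j + i` is
the attenuated wave of the last of them. -/
theorem follows_imaginary {j i : ℕ} (hi : j + i ≤ S.N) (hj : S.Distinct j (j + 1)) {σ : ℂ}
    (hσ : σ ^ 2 = 1) :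
    Follows atTop (fun y : ℝ => y) False
      (fun y : ℝ => stackMatrix (S.layerChar p (y * Complex.I)) j i *ᵥ
        ![1, σ * p.single (S.posIndex j y)])
      (fun y : ℝ => ![1, (if i = 0 then σ else 1) * p.single (S.posIndex (j + i) y)]) := by
  have hz : Tendsto (fun y : ℝ => y) atTop atTop := tendsto_id
  induction i with
  | zero => simpa [stackMatrix] using follows_refl _
  | succ i ih =>
    have hm : j + i + 1 ≤ S.N + 1 := by lia
    have hg := S.polyBdd_single_posIndex p hm
    have step := (ih (by lia)).layer hz (g := fun y => p.single (S.posIndex (j + i + 1) y))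
      (δ := fun y => (S.posIndex (j + i + 1) y : ℂ) *
        (S.thickness (j + i + 1) * (y * Complex.I) / S.c)) ?_ hg.1 hg.2 ?_
      (S.negligible_exp_imaginary (by lia) (by lia)) ?_
    · simp only [Nat.add_eq_zero_iff, one_ne_zero, and_false, if_false, one_mul]
      refine (step.congr ?_).mono False.elim
      filter_upwards [eventually_gt_atTop 0] with y hy
      have h1 := S.posIndex_spec hm hy
      rw [stackMatrix, ← Matrix.mulVec_mulVec,
        S.layerChar_eq p (by exact_mod_cast h1.1.ne' : (S.posIndex (j + i + 1) y : ℂ) ≠ 0) h1.2.1]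
    · intro a
      fin_cases a
      · simpa using polyBdd_const 1
      · simpa using (polyBdd_const (if i = 0 then σ else 1)).mul
          (S.polyBdd_single_posIndex p (by lia : j + i ≤ S.N + 1)).1
    · filter_upwards [eventually_gt_atTop 0] with y hy
      exact p.single_ne_zero (by exact_mod_cast (S.posIndex_spec hm hy).1.ne')
    -- Only at the first interface can the sign σ cause cancellation, which distinctness excludes;
    -- behind a layer the wave has the sign +1.
    · by_cases h0 : i = 0
      · subst h0
        simpa using hj.polyInv_one_add S p (by lia) hm hσ
      · simpa [h0] using S.polyInv_one_add_posIndex p (by lia : j + i ≤ S.N + 1) hm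

/-- In front of the last interface the field is a multiple of (1, ± g), so the factor reduces to 1 ±
g_{j+i} / g_{j+i+1}; this is where distinctness at the far end enters. -/
theorem eventually_interfaceFactor_ne_zero {j i : ℕ} (hi : j + i ≤ S.N)
    (hj : S.Distinct j (j + 1)) (hk : S.Distinct (j + i) (j + i + 1)) {σ τ : ℂ}
    (hσ : σ ^ 2 = 1) (hτ : τ ^ 2 = 1) :
    ∀ᶠ y : ℝ in atTop, interfaceFactor (stackMatrix (S.layerChar p (y * Complex.I)) j i)
      (σ * p.single (S.posIndex j y)) (τ * (p.single (S.posIndex (j + i + 1) y))⁻¹) ≠ 0 := by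
  have hz : Tendsto (fun y : ℝ => y) atTop atTop := tendsto_id
  have hm : j + i + 1 ≤ S.N + 1 := by lia
  have key := (S.follows_imaginary p hi hj hσ).contract hz (c := fun _ => 1)
    (d := fun y => τ * (p.single (S.posIndex (j + i + 1) y))⁻¹) (polyBdd_const 1)
    ((polyBdd_const τ).mul (S.polyBdd_single_posIndex p hm).2) ?_
  · filter_upwards [key.1.1] with y hy
    rw [interfaceFactor, mul_comm _ (τ * _)]
    rwa [one_mul] at hy
  · have hs : (τ * (if i = 0 then σ else 1)) ^ 2 = 1 := by
      rw [mul_pow, hτ]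
      split_ifs <;> simp [hσ]
    refine (hk.polyInv_one_add S p (by lia) hm hs).congr (Eventually.of_forall fun y => ?_)
    simp only [Matrix.cons_val_zero, Matrix.cons_val_one]
    ring

/-- The sign product of the layers `j + 1, …, j + i` between media `j` and `j + i + 1`. -/
noncomputable def blockProd (j i : ℕ) (ω : ℂ) : ℂ :=
  signProd (p.single (S.indexSq j ω)) (p.single (S.indexSq (j + i + 1) ω))⁻¹
    (stackMatrix (S.layerChar p ω) j i)

theorem eventually_blockProd_imaginary_ne_zero {j i : ℕ} (hi : j + i ≤ S.N)
    (hj : S.Distinct j (j + 1)) (hk : S.Distinct (j + i) (j + i + 1)) :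
    ∀ᶠ y : ℝ in atTop, S.blockProd p j i (y * Complex.I) ≠ 0 := by
  have h := fun σ τ hσ hτ =>
    S.eventually_interfaceFactor_ne_zero p hi hj hk (σ := σ) (τ := τ) hσ hτ
  filter_upwards [h 1 1 (by simp) (by simp), h (-1) 1 (by simp) (by simp),
    h 1 (-1) (by simp) (by simp), h (-1) (-1) (by simp) (by simp),
    S.eventually_posIndex_sq p (by lia : j ≤ S.N + 1),
    S.eventually_posIndex_sq p (by lia : j + i + 1 ≤ S.N + 1)] with y h1 h2 h3 h4 h5 h6
  rw [blockProd, ← h5, ← h6, ← inv_pow, signProd_sq]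
  simp only [one_mul, neg_mul] at h1 h2 h3 h4
  exact mul_ne_zero h1 (mul_ne_zero h2 (mul_ne_zero h3 h4))

theorem analyticAt_signProd {G L : ℂ → ℂ} {M : ℂ → Matrix (Fin 2) (Fin 2) ℂ} {x : ℂ}
    (hG : AnalyticAt ℂ G x) (hL : AnalyticAt ℂ L x)
    (hM : ∀ a b, AnalyticAt ℂ (fun z => M z a b) x) :
    AnalyticAt ℂ (fun z => signProd (G z) (L z) (M z)) x := by
  have h1 := hM 0 0
  have h2 := hM 0 1
  have h3 := hM 1 0
  have h4 := hM 1 1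
  simp only [signProd]
  fun_prop

/-- The end media may be resonant at `a`: they enter only through their squared coefficients, which
are rational in ω. -/
theorem meromorphicAt_blockProd {j i : ℕ} {a : ℂ}
    (h : ∀ m, j + 1 ≤ m → m ≤ j + i → (S.den m).eval a ≠ 0) :
    MeromorphicAt (S.blockProd p j i) a := by
  have hM : ∀ b c, MeromorphicAt (fun z => stackMatrix (S.layerChar p z) j i b c) a :=
    fun b c => (analyticAt_stackMatrix (M := S.layerChar p)
      (fun m h1 h2 => S.analyticAt_layerChar p (h m h1 h2)) b c).meromorphicAt
  have hG := p.meromorphicAt_single (S.meromorphicAt_indexSq j a)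
  have hL := (p.meromorphicAt_single (S.meromorphicAt_indexSq (j + i + 1) a)).fun_inv
  have h1 := hM 0 0
  have h2 := hM 0 1
  have h3 := hM 1 0
  have h4 := hM 1 1
  unfold blockProd signProd
  fun_prop

/-- By analytic continuation to the imaginary axis, the sign product vanishes identically near no
point. -/
theorem not_eventually_blockProd_eq_zero {j i : ℕ} (hi : j + i ≤ S.N)
    (hj : S.Distinct j (j + 1)) (hk : S.Distinct (j + i) (j + i + 1)) (a : ℂ) :
    ¬ ∀ᶠ ω in 𝓝[≠] a, S.blockProd p j i ω = 0 := by
  intro h0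
  set U : Set ℂ := (S.exceptional : Set ℂ)ᶜ with hU
  have hUc : IsPreconnected U :=
    (S.exceptional.countable_toSet.isConnected_compl_of_one_lt_rank (by
      rw [Complex.rank_real_complex]; norm_num)).isPreconnected
  have hmem : ∀ ω ∈ U, ∀ m, m ≤ S.N + 1 → (S.num m).eval ω ≠ 0 ∧ (S.den m).eval ω ≠ 0 :=
    fun ω hω => S.not_mem_exceptional.1 hω
  have hA : AnalyticOnNhd ℂ (S.blockProd p j i) U := by
    intro ω hω
    have hnd := hmem ω hω
    have hw : ∀ m, m ≤ S.N + 1 → S.indexSq m ω ≠ 0 := fun m hm =>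
      div_ne_zero (hnd m hm).1 (hnd m hm).2
    have hs : ∀ m, m ≤ S.N + 1 → AnalyticAt ℂ (fun z => p.single (S.indexSq m z)) ω := fun m hm =>
      p.analyticAt_single (S.analyticAt_indexSq (hnd m hm).2) (hw m hm)
    refine analyticAt_signProd (hs j (by lia))
      ((hs (j + i + 1) (by lia)).fun_inv (p.single_ne_zero (hw _ (by lia)))) fun b c => ?_
    exact analyticAt_stackMatrix (M := S.layerChar p)
      (fun m h1 h2 => S.analyticAt_layerChar p (hnd m (by lia)).2) b c
  -- Since `a` itself may be exceptional, continuation starts at a nearby regular point; the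
  -- complement of the finite exceptional set is connected.
  obtain ⟨ω₀, h1, h2⟩ :=
    ((eventually_eventually_nhdsWithin.2 h0).and (S.eventually_not_mem_exceptional a)).and
      self_mem_nhdsWithin |>.exists
  have h3 : ∀ᶠ ω in 𝓝 ω₀, S.blockProd p j i ω = 0 := by
    rw [← isOpen_compl_singleton.nhdsWithin_eq h2]
    exact h1.1
  have h4 := hA.eqOn_zero_of_preconnected_of_eventuallyEq_zero hUc (z₀ := ω₀) h1.2 h3
  obtain ⟨y, hy1, hy2⟩ := ((S.eventually_blockProd_imaginary_ne_zero p hi hj hk).and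
    (eventually_gt_atTop 0)).exists
  refine hy1 (h4 (S.not_mem_exceptional.2 fun m hm => ?_))
  obtain ⟨r, s, hr, hs, e1, e2, -⟩ := S.exists_pos_eval_imaginary hm hy2
  rw [e1, e2]
  exact ⟨by exact_mod_cast hr.ne', by exact_mod_cast hs.ne'⟩

end LorentzStack

/-! ### Attenuating directions at a resonance -/

/-- `(Im δ)² = (|δ²| - Re δ²) / 2`. -/
theorem im_sq_eq (δ : ℂ) : δ.im ^ 2 = (‖δ ^ 2‖ - (δ ^ 2).re) / 2 := by
  rw [norm_pow, Complex.sq_norm, Complex.normSq_apply, pow_two, pow_two, Complex.mul_re]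
  ring

/-- The condition is a polynomial equation in τ whose coefficients of degree 0 and 1 are Im K and q
Re K, not both zero. -/
theorem finite_setOf_im_eq_zero {K : ℂ} (hK : K ≠ 0) {q : ℕ} (hq : q = 1 ∨ q = 2) :
    {τ : ℝ | (K * (1 + τ * Complex.I) ^ q).im = 0}.Finite := by
  have key : ∀ c : ℝ, c ≠ 0 → ∀ d : ℝ,
      {τ : ℝ | K.im + c * K.re * τ + d * τ ^ 2 = 0}.Finite := by
    intro c hc d
    set P : Polynomial ℝ := Polynomial.C K.im + Polynomial.C (c * K.re) * Polynomial.X +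
      Polynomial.C d * Polynomial.X ^ 2 with hP
    have hP0 : P ≠ 0 := by
      intro h
      have h0 : K.im = 0 := by
        have := congrArg (fun r => Polynomial.coeff r 0) h
        simpa [hP] using this
      have h1 : K.re = 0 := by
        have := congrArg (fun r => Polynomial.coeff r 1) h
        simpa [hP, Polynomial.coeff_X, hc, Polynomial.coeff_C] using this
      exact hK (Complex.ext h1 h0)
    refine (Polynomial.finite_setOfPred_isRoot hP0).subset fun τ hτ => ?_
    simpa [hP, Polynomial.IsRoot.def] using hτ
  rcases hq with rfl | rfl
  · refine (key 1 one_ne_zero 0).subset fun τ hτ => ?_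
    simp at hτ ⊢
    linarith
  · refine (key 2 two_ne_zero (-K.im)).subset fun τ hτ => ?_
    simp [pow_two] at hτ ⊢
    linarith

/-- Finitely many conditions `Im (K / v ^ q) ≠ 0` can be satisfied simultaneously. -/
theorem exists_generic_direction {ι : Type*} (s : Finset ι) (K : ι → ℂ) (q : ι → ℕ)
    (hK : ∀ i ∈ s, K i ≠ 0) (hq : ∀ i ∈ s, q i = 1 ∨ q i = 2) :
    ∃ v : ℂ, v ≠ 0 ∧ ∀ i ∈ s, (K i / v ^ q i).im ≠ 0 := by
  have hfin : (⋃ i ∈ s, {τ : ℝ | (K i * (1 + τ * Complex.I) ^ q i).im = 0}).Finite :=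
    s.finite_toSet.biUnion fun i hi => finite_setOf_im_eq_zero (hK i hi) (hq i hi)
  obtain ⟨τ, hτ⟩ := hfin.infinite_compl.nonempty
  have h0 : (1 + τ * Complex.I : ℂ) ≠ 0 := by
    intro h
    have := congrArg Complex.re h
    simp at this
  refine ⟨(1 + τ * Complex.I)⁻¹, inv_ne_zero h0, fun i hi h => hτ ?_⟩
  rw [inv_pow, div_inv_eq_mul] at h
  exact Set.mem_biUnion hi h

/-- A square root `δ` with nonnegative imaginary part of a function with a pole along a ray has
large imaginary part, if the leading coefficient is not real. -/
theorem eventually_le_im_sq {δ : ℝ → ℂ} {K : ℂ} (hK : K.im ≠ 0) {q : ℕ} (hq : 1 ≤ q)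
    (h : Tendsto (fun x : ℝ => (x : ℂ) ^ q * δ x ^ 2) (𝓝[>] 0) (𝓝 K)) :
    ∃ c : ℝ, 0 < c ∧ ∀ᶠ x : ℝ in 𝓝[>] 0, c * x⁻¹ ≤ (δ x).im ^ 2 := by
  have hpos : 0 < (‖K‖ - K.re) / 2 := by
    have h1 : |K.re| < ‖K‖ := Complex.abs_re_lt_norm.2 hK
    have := le_abs_self K.re
    linarith
  have h1 : Tendsto (fun x : ℝ => x ^ q * (δ x).im ^ 2) (𝓝[>] 0) (𝓝 ((‖K‖ - K.re) / 2)) := by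
    have h2 := ((h.norm).sub ((Complex.continuous_re.tendsto K).comp h)).div_const 2
    refine h2.congr' ?_
    filter_upwards [self_mem_nhdsWithin] with x hx
    have hx : 0 < x := hx
    simp only [Function.comp_apply]
    rw [im_sq_eq, norm_mul, norm_pow, Complex.norm_real, Real.norm_of_nonneg hx.le,
      ← Complex.ofReal_pow, Complex.re_ofReal_mul]
    ring
  refine ⟨(‖K‖ - K.re) / 2 / 2, by positivity, ?_⟩
  filter_upwards [h1.eventually_const_lt (half_lt_self hpos), Ioo_mem_nhdsGT one_pos] with x h2 hx
  have hx0 : 0 < x := hx.1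
  rw [← div_eq_mul_inv, div_le_iff₀ hx0]
  refine h2.le.trans ?_
  rw [mul_comm]
  have : x ^ q ≤ x := by
    simpa using pow_le_pow_of_le_one hx0.le hx.2.le hq
  gcongr

namespace LorentzStack

open Polynomial

variable (S : LorentzStack) (p : Polarization)

/-- The index of medium `m` at frequency `ω`; in the layers the root with `Im (n ω) ≥ 0`. -/
noncomputable def rayIndex (m : ℕ) (ω : ℂ) : ℂ :=
  if m = 0 then S.nIn else if m = S.N + 1 then S.nOut else
    if 0 ≤ (S.indexSq m ω ^ (1 / 2 : ℂ) * ω).im then S.indexSq m ω ^ (1 / 2 : ℂ)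
    else -S.indexSq m ω ^ (1 / 2 : ℂ)

theorem rayIndex_sq (m : ℕ) (ω : ℂ) : S.rayIndex m ω ^ 2 = S.indexSq m ω := by
  rw [rayIndex]
  split_ifs with h1 h2 h3
  · rw [h1, indexSq_zero]
  · rw [h2, indexSq_last]
  · rw [cpow_half_sq]
  · rw [neg_sq, cpow_half_sq]

theorem im_rayIndex_mul_nonneg {m : ℕ} (h1 : 1 ≤ m) (h2 : m ≤ S.N) (ω : ℂ) :
    0 ≤ (S.rayIndex m ω * ω).im := by
  rw [rayIndex, if_neg (by lia), if_neg (by lia)]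
  split_ifs with h3
  · exact h3
  · rw [neg_mul, Complex.neg_im]
    linarith

/-- The phase of layer `m` for the index `rayIndex`. -/
noncomputable def rayPhase (m : ℕ) (ω : ℂ) : ℂ :=
  S.rayIndex m ω * (S.thickness m * ω / S.c)

theorem im_rayPhase (m : ℕ) (ω : ℂ) :
    (S.rayPhase m ω).im = S.thickness m / S.c * (S.rayIndex m ω * ω).im := by
  have : S.rayPhase m ω = ((S.thickness m / S.c : ℝ) : ℂ) * (S.rayIndex m ω * ω) := by
    rw [rayPhase]; push_cast; ring
  rw [this, Complex.im_ofReal_mul]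

theorem eval_den_add {m : ℕ} (h1 : 1 ≤ m) (h2 : m ≤ S.N) {a : ℂ} (ha : (S.den m).eval a = 0)
    (s : ℂ) : (S.den m).eval (a + s) = -(s * (s + (2 * a + Complex.I * S.damping m))) := by
  rw [S.den_layer h1 h2, lorentzDenom] at ha ⊢
  linear_combination ha

theorem ne_zero_of_eval_den {m : ℕ} (h1 : 1 ≤ m) (h2 : m ≤ S.N) {a : ℂ}
    (ha : (S.den m).eval a = 0) : a ≠ 0 := by
  rintro rfl
  rw [S.den_layer h1 h2, lorentzDenom] at ha
  have := (S.charFreq_pos m h1 h2).ne'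
  simp [this] at ha

/-- Leading behaviour of the squared phase of a resonant layer. -/
theorem exists_tendsto_rayPhase_sq {m : ℕ} (h1 : 1 ≤ m) (h2 : m ≤ S.N) {a : ℂ}
    (ha : (S.den m).eval a = 0) :
    ∃ (K : ℂ) (q : ℕ), K ≠ 0 ∧ (q = 1 ∨ q = 2) ∧ ∀ v : ℂ, v ≠ 0 →
      Tendsto (fun x : ℝ => (x : ℂ) ^ q * S.rayPhase m (a + x * v) ^ 2) (𝓝[>] 0)
        (𝓝 (K / v ^ q)) := by
  have hnum := (S.num_ne_zero_of_den_eq_zero (by lia) ha).2.2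
  have ha0 := S.ne_zero_of_eval_den h1 h2 ha
  have hd : (S.thickness m : ℂ) ≠ 0 := by exact_mod_cast (S.thickness_pos m h1 h2).ne'
  have hc : (S.c : ℂ) ≠ 0 := by exact_mod_cast S.c_pos.ne'
  set A : ℂ → ℂ := fun ω => (S.num m).eval ω * (S.thickness m * ω / S.c) ^ 2 with hA
  have hAa : A a ≠ 0 := by
    simp only [hA]
    positivity
  have hAcont : Continuous A := by
    simp only [hA]
    fun_prop
  have hAt : ∀ v : ℂ, Tendsto (fun x : ℝ => A (a + x * v)) (𝓝[>] 0) (𝓝 (A a)) := fun v =>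
    (Continuous.tendsto' (by fun_prop) _ _ (by simp)).mono_left nhdsWithin_le_nhds
  have hphase : ∀ ω, S.rayPhase m ω ^ 2 = A ω / (S.den m).eval ω := fun ω => by
    rw [rayPhase, mul_pow, S.rayIndex_sq, indexSq]
    simp only [hA]
    ring
  set b : ℂ := 2 * a + Complex.I * S.damping m with hb
  have hden := S.eval_den_add h1 h2 ha
  rw [← hb] at hden
  -- b vanishes exactly when a is a double root (critical damping). The squared phase then has a
  -- double pole, otherwise a simple one.
  by_cases hb0 : b = 0
  · refine ⟨-A a, 2, neg_ne_zero.2 hAa, Or.inr rfl, fun v hv => ?_⟩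
    refine (((hAt v).neg).div_const (v ^ 2)).congr' ?_
    filter_upwards [self_mem_nhdsWithin] with x hx
    have hx : (x : ℂ) ≠ 0 := by exact_mod_cast (ne_of_gt hx)
    rw [hphase, hden, hb0]
    field_simp
    rw [add_zero, mul_comm]
  · refine ⟨-(A a / b), 1, neg_ne_zero.2 (div_ne_zero hAa hb0), Or.inl rfl, fun v hv => ?_⟩
    have hlin : Tendsto (fun x : ℝ => (x * v + b : ℂ)) (𝓝[>] 0) (𝓝 b) :=
      (Continuous.tendsto' (by fun_prop) _ _ (by simp)).mono_left nhdsWithin_le_nhds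
    have := (((hAt v).div hlin hb0).neg).div_const (v ^ 1)
    refine this.congr' ?_
    filter_upwards [self_mem_nhdsWithin, hlin.eventually_ne hb0] with x hx hx'
    have hx : (x : ℂ) ≠ 0 := by exact_mod_cast (ne_of_gt hx)
    simp only [Pi.div_apply]
    rw [hphase, hden]
    field_simp

/-- Along the direction `v` all resonant layers attenuate strongly near `a`. -/
def IsAttenuating (a v : ℂ) : Prop :=
  v ≠ 0 ∧ ∀ m, 1 ≤ m → m ≤ S.N → (S.den m).eval a = 0 →
    ∃ c : ℝ, 0 < c ∧ ∀ᶠ x : ℝ in 𝓝[>] 0, c * x⁻¹ ≤ (S.rayPhase m (a + x * v)).im ^ 2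

/-- Each resonant layer excludes finitely many directions of the family 1 / (1 + iτ). The condition
Im (K / v^q) ≠ 0 is unchanged under v ↦ -v, which provides the opposite rays needed for the zeros.
-/
theorem exists_isAttenuating (a : ℂ) : ∃ v : ℂ, S.IsAttenuating a v ∧ S.IsAttenuating a (-v) := by
  classical
  have h := fun m (hm : m ∈ (Finset.Icc 1 S.N).filter fun m => (S.den m).eval a = 0) => by
    rw [Finset.mem_filter, Finset.mem_Icc] at hm
    exact S.exists_tendsto_rayPhase_sq hm.1.1 hm.1.2 hm.2
  choose! K q hK hq ht using h
  obtain ⟨v, hv, him⟩ := exists_generic_direction _ K q hK hq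
  have main : ∀ u : ℂ, u ≠ 0 → (∀ m ∈ (Finset.Icc 1 S.N).filter fun m => (S.den m).eval a = 0,
      (K m / u ^ q m).im ≠ 0) → S.IsAttenuating a u := by
    intro u hu hm
    refine ⟨hu, fun m h1 h2 h3 => ?_⟩
    have hmem : m ∈ (Finset.Icc 1 S.N).filter fun m => (S.den m).eval a = 0 := by
      rw [Finset.mem_filter, Finset.mem_Icc]
      exact ⟨⟨h1, h2⟩, h3⟩
    exact eventually_le_im_sq (hm m hmem) (by rcases hq m hmem with h | h <;> lia)
      (ht m hmem u hu)
  refine ⟨v, main v hv him, main (-v) (neg_ne_zero.2 hv) fun m hm => ?_⟩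
  have := him m hm
  rcases hq m hm with h | h
  · rw [h, pow_one] at this ⊢
    rwa [div_neg, Complex.neg_im, neg_ne_zero]
  · rw [h] at this ⊢
    rwa [neg_sq]

variable {S} {a v : ℂ}

/-- The bound on (Im δ)² leaves the sign of Im δ open; `rayIndex` was chosen to make it nonnegative.
-/
theorem IsAttenuating.negligible_exp (hv : S.IsAttenuating a v) {m : ℕ} (h1 : 1 ≤ m)
    (h2 : m ≤ S.N) (ha : (S.den m).eval a = 0) :
    (∀ᶠ x : ℝ in 𝓝[>] 0, 1 ≤ (S.rayPhase m (a + x * v)).im) ∧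
    Negligible (𝓝[>] 0) (fun x : ℝ => x⁻¹)
      fun x : ℝ => Complex.exp (Complex.I * S.rayPhase m (a + x * v)) := by
  obtain ⟨c, hc, hev⟩ := hv.2 m h1 h2 ha
  have hpos : ∀ᶠ x : ℝ in 𝓝[>] 0, 1 ≤ (S.rayPhase m (a + x * v)).im := by
    filter_upwards [hev, tendsto_inv_scale.eventually_ge_atTop c⁻¹] with x hx hx2
    have h3 : 0 ≤ (S.rayPhase m (a + x * v)).im := by
      rw [S.im_rayPhase]
      have := S.thickness_pos m h1 h2
      have := S.c_pos
      have := S.im_rayIndex_mul_nonneg h1 h2 (a + x * v)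
      positivity
    have h4 : 1 ≤ c * x⁻¹ := by
      calc 1 = c * c⁻¹ := by field_simp
        _ ≤ c * x⁻¹ := by gcongr
    nlinarith
  exact ⟨hpos, _root_.negligible_exp tendsto_inv_scale hc (hpos.mono fun x hx => by linarith) hev⟩

/-! ### Growth of the reduced denominator along an attenuating ray -/

variable (S)

/-- `rayIndex` may jump along the ray, but its square is meromorphic, and polynomial bounds pass to
square roots. -/
theorem polyBdd_single_rayIndex (hv : v ≠ 0) (m : ℕ) :
    PolyBdd (𝓝[>] 0) (fun x : ℝ => x⁻¹) (fun x : ℝ => p.single (S.rayIndex m (a + x * v))) ∧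
      PolyBdd (𝓝[>] 0) (fun x : ℝ => x⁻¹)
        fun x : ℝ => (p.single (S.rayIndex m (a + x * v)))⁻¹ := by
  have hm := p.meromorphicAt_single (S.meromorphicAt_indexSq m a)
  constructor
  · refine PolyBdd.of_sq tendsto_inv_scale ((hm.polyBdd_ray hv).congr
      (Eventually.of_forall fun x => ?_))
    simp only [p.single_sq, S.rayIndex_sq]
  · refine PolyBdd.of_sq tendsto_inv_scale ((hm.fun_inv.polyBdd_ray hv).congr
      (Eventually.of_forall fun x => ?_))
    simp only [inv_pow, p.single_sq, S.rayIndex_sq]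

theorem eventually_rayIndex_ne_zero (hv : v ≠ 0) {m : ℕ} (hm : m ≤ S.N + 1) :
    ∀ᶠ x : ℝ in 𝓝[>] 0, S.rayIndex m (a + x * v) ≠ 0 := by
  filter_upwards [(tendsto_ray hv).eventually (S.eventually_not_mem_exceptional a)] with x hx h0
  have h1 := S.not_mem_exceptional.1 hx m hm
  have h2 := S.rayIndex_sq m (a + x * v)
  rw [h0, zero_pow two_ne_zero, indexSq, eq_comm, div_eq_zero_iff] at h2
  exact h2.elim h1.1 h1.2

theorem polyBdd_stackMatrix_ray (hv : v ≠ 0) {j i : ℕ}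
    (h : ∀ m, j + 1 ≤ m → m ≤ j + i → (S.den m).eval a ≠ 0) (b c : Fin 2) :
    PolyBdd (𝓝[>] 0) (fun x : ℝ => x⁻¹)
      fun x : ℝ => stackMatrix (S.layerChar p (a + x * v)) j i b c :=
  (analyticAt_stackMatrix (M := S.layerChar p)
    (fun m h1 h2 => S.analyticAt_layerChar p (h m h1 h2)) b c).meromorphicAt.polyBdd_ray hv

theorem polyBdd_mulVec {ι : Type*} {l : Filter ι} {z : ι → ℝ} (hz : Tendsto z l atTop)
    {M : ι → Matrix (Fin 2) (Fin 2) ℂ} (hM : ∀ a b, PolyBdd l z fun i => M i a b) {g : ι → ℂ}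
    (hg : PolyBdd l z g) (b : Fin 2) : PolyBdd l z fun i => (M i *ᵥ ![1, g i]) b := by
  simpa [Matrix.mulVec, dotProduct, Fin.sum_univ_two] using
    (hM b 0).add hz ((hM b 1).mul hg)

theorem polyBdd_interfaceFactor {ι : Type*} {l : Filter ι} {z : ι → ℝ} (hz : Tendsto z l atTop)
    {M : ι → Matrix (Fin 2) (Fin 2) ℂ} (hM : ∀ a b, PolyBdd l z fun i => M i a b) {g h : ι → ℂ}
    (hg : PolyBdd l z g) (hh : PolyBdd l z h) :
    PolyBdd l z fun i => interfaceFactor (M i) (g i) (h i) :=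
  (polyBdd_mulVec hz hM hg 0).add hz ((polyBdd_mulVec hz hM hg 1).mul hh)

/-- The interface factor of a block of nonresonant layers between different media. -/
theorem polyInv_interfaceFactor_of_distinct (hv : v ≠ 0) {j i : ℕ} (hi : j + i ≤ S.N)
    (hj : S.Distinct j (j + 1)) (hk : S.Distinct (j + i) (j + i + 1))
    (h : ∀ m, j + 1 ≤ m → m ≤ j + i → (S.den m).eval a ≠ 0) :
    PolyInv (𝓝[>] 0) (fun x : ℝ => x⁻¹) fun x : ℝ =>
      interfaceFactor (stackMatrix (S.layerChar p (a + x * v)) j i)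
        (p.single (S.rayIndex j (a + x * v))) (p.single (S.rayIndex (j + i + 1) (a + x * v)))⁻¹ := by
  have hz := tendsto_inv_scale
  have hM := S.polyBdd_stackMatrix_ray p hv h
  have hg := (S.polyBdd_single_rayIndex p hv j (a := a)).1
  have hh := (S.polyBdd_single_rayIndex p hv (j + i + 1) (a := a)).2
  have key := (S.meromorphicAt_blockProd p h).polyInv_ray hv
    (S.not_eventually_blockProd_eq_zero p hi hj hk a)
  -- The three other conjugates are polynomially bounded, so invertibility of the product passes to
  -- the wanted factor.
  refine PolyInv.of_mul_left (key.congr (Eventually.of_forall fun x => ?_))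
    ((polyBdd_interfaceFactor hz hM hg.neg hh).mul ((polyBdd_interfaceFactor hz hM hg hh.neg).mul
      (polyBdd_interfaceFactor hz hM hg.neg hh.neg)))
  simp only [blockProd]
  rw [← S.rayIndex_sq, ← S.rayIndex_sq, ← p.single_sq, ← p.single_sq, ← inv_pow,
    signProd_sq]

/-- The interface factor of two adjacent resonant layers. -/
theorem polyInv_interfaceFactor_of_resonant (hv : S.IsAttenuating a v) {j : ℕ} (h1 : 1 ≤ j)
    (h2 : j + 1 ≤ S.N) (hj : (S.den j).eval a = 0) :
    PolyInv (𝓝[>] 0) (fun x : ℝ => x⁻¹) fun x : ℝ =>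
      interfaceFactor (stackMatrix (S.layerChar p (a + x * v)) j 0)
        (p.single (S.rayIndex j (a + x * v))) (p.single (S.rayIndex (j + 1) (a + x * v)))⁻¹ := by
  have hd := S.thickness_pos j h1 (by lia)
  have hc := S.c_pos
  -- The two layers may be of the same medium. But Im (n ω) is at least c / d_j in layer j and
  -- nonnegative in layer j + 1, so the sum of the indices stays away from 0.
  have hsum : PolyInv (𝓝[>] 0) (fun x : ℝ => x⁻¹)
      fun x : ℝ => S.rayIndex j (a + x * v) + S.rayIndex (j + 1) (a + x * v) := by
    refine polyInv_of_le_norm (c := S.c / S.thickness j / (‖a‖ + 1)) (by positivity) ?_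
    have hbd : Tendsto (fun x : ℝ => ‖a + x * v‖) (𝓝[>] 0) (𝓝 ‖a‖) :=
      (((tendsto_ray hv.1).mono_right nhdsWithin_le_nhds)).norm
    filter_upwards [(hv.negligible_exp h1 (by lia) hj).1,
      hbd.eventually_lt_const (lt_add_one ‖a‖)] with x h3 h4
    rw [S.im_rayPhase] at h3
    have h5 := S.im_rayIndex_mul_nonneg (m := j + 1) (by lia) h2 (a + x * v)
    have h6 : S.c / S.thickness j ≤ (S.rayIndex j (a + x * v) * (a + x * v)).im := by
      rw [div_le_iff₀ hd]
      rw [div_mul_eq_mul_div, le_div_iff₀ hc] at h3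
      linarith
    rw [div_le_iff₀ (by positivity)]
    calc S.c / S.thickness j ≤ ((S.rayIndex j (a + x * v) + S.rayIndex (j + 1) (a + x * v)) *
          (a + x * v)).im := by
          rw [add_mul, Complex.add_im]
          linarith
      _ ≤ ‖(S.rayIndex j (a + x * v) + S.rayIndex (j + 1) (a + x * v)) * (a + x * v)‖ :=
          Complex.im_le_norm _
      _ ≤ ‖S.rayIndex j (a + x * v) + S.rayIndex (j + 1) (a + x * v)‖ * (‖a‖ + 1) := by
          rw [norm_mul]
          gcongr
  have hone : ∀ g h : ℂ, interfaceFactor (1 : Matrix (Fin 2) (Fin 2) ℂ) g h = 1 + g * h := by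
    intro g h
    simp [interfaceFactor]
  simp only [stackMatrix, hone]
  have hne := S.eventually_rayIndex_ne_zero hv.1 (a := a) (by lia : j ≤ S.N + 1)
  have hne' := S.eventually_rayIndex_ne_zero hv.1 (a := a) (by lia : j + 1 ≤ S.N + 1)
  have hb := fun m => (S.polyBdd_single_rayIndex .TE hv.1 m (a := a)).1
  cases p
  · refine (hsum.mul (PolyInv.inv (hb (j + 1)) hne')).congr ?_
    filter_upwards [hne'] with x hx
    simp only [Polarization.single]
    field_simp
    ring
  · refine (hsum.mul (PolyInv.inv (hb j) hne)).congr ?_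
    filter_upwards [hne] with x hx
    simp only [Polarization.single]
    field_simp

/-- The interface factor between consecutive resonant layers or half-spaces. -/
theorem polyInv_interfaceFactor (hv : S.IsAttenuating a v) {j i : ℕ} (hi : j + i ≤ S.N)
    (hj : j = 0 ∨ (1 ≤ j ∧ (S.den j).eval a = 0))
    (hk : j + i = S.N ∨ (S.den (j + i + 1)).eval a = 0) (hN : ¬ (j = 0 ∧ j + i = S.N))
    (h : ∀ m, j + 1 ≤ m → m ≤ j + i → (S.den m).eval a ≠ 0) :
    PolyInv (𝓝[>] 0) (fun x : ℝ => x⁻¹) fun x : ℝ =>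
      interfaceFactor (stackMatrix (S.layerChar p (a + x * v)) j i)
        (p.single (S.rayIndex j (a + x * v))) (p.single (S.rayIndex (j + i + 1) (a + x * v)))⁻¹ := by
  by_cases hres : i = 0 ∧ 1 ≤ j ∧ j + i + 1 ≤ S.N
  · obtain ⟨rfl, h1, h2⟩ := hres
    exact S.polyInv_interfaceFactor_of_resonant p hv h1 h2 (hj.resolve_left (by lia)).2
  · have hhalf : ∀ m, m = 0 ∨ m = S.N + 1 → ∀ m', 1 ≤ m' → m' ≤ S.N → S.Distinct m m' :=
      fun m hm m' h1 h2 => (S.distinct_layer_halfSpace h1 h2 hm).symm S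
    refine S.polyInv_interfaceFactor_of_distinct p hv.1 hi ?_ ?_ h
    · rcases hj with rfl | ⟨h1, h2⟩
      · exact hhalf 0 (Or.inl rfl) _ (by lia) (by lia)
      · rcases Nat.eq_zero_or_pos i with rfl | hpos
        · exact (hhalf (j + 1) (by lia) j h1 (by lia)).symm S
        · exact S.distinct_of_den_eq_zero (by lia) h2 (h _ (by lia) (by lia))
    · by_cases hlast : j + i = S.N
      · exact (hhalf (j + i + 1) (by lia) (j + i) (by lia) hi).symm S
      · have h2 := hk.resolve_left hlast
        rcases Nat.eq_zero_or_pos i with rfl | hpos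
        · exact hhalf _ (by lia) _ (by lia) (by lia)
        · exact (S.distinct_of_den_eq_zero (by lia) h2 (h _ (by lia) (by lia))).symm S

/-- Along an attenuating ray the field behind layer `m` is, up to an amplitude, the one excited by
the last resonant layer. -/
theorem exists_follows_ray (hv : S.IsAttenuating a v) {m : ℕ} (hm : m ≤ S.N) :
    ∃ j i, j + i = m ∧ (j = 0 ∨ (1 ≤ j ∧ (S.den j).eval a = 0)) ∧
      (∀ k, j + 1 ≤ k → k ≤ j + i → (S.den k).eval a ≠ 0) ∧
      Follows (𝓝[>] 0) (fun x : ℝ => x⁻¹) (1 ≤ j)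
        (fun x : ℝ => stackMatrix (S.layerChar p (a + x * v)) 0 m *ᵥ ![1, p.single S.nIn])
        (fun x : ℝ => stackMatrix (S.layerChar p (a + x * v)) j i *ᵥ
          ![1, p.single (S.rayIndex j (a + x * v))]) := by
  have hz := tendsto_inv_scale
  induction m with
  | zero =>
    refine ⟨0, 0, rfl, Or.inl rfl, by lia, ?_⟩
    simpa [rayIndex] using (follows_refl _).mono (by lia)
  | succ m ih =>
    obtain ⟨j, i, hji, hj, hnon, hF⟩ := ih (by lia)
    -- A resonant layer resets the reference vector to its own (1, g); a nonresonant one is appended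
    -- to the current block.
    by_cases hres : (S.den (m + 1)).eval a = 0
    · have hg := S.polyBdd_single_rayIndex p hv.1 (m + 1) (a := a)
      have hne := S.eventually_rayIndex_ne_zero hv.1 (a := a) (by lia : m + 1 ≤ S.N + 1)
      have hB := S.polyInv_interfaceFactor p hv (j := j) (i := i) (by lia) hj
        (Or.inr (by rwa [hji])) (by lia) hnon
      rw [hji] at hB
      have step := hF.layer hz
        (polyBdd_mulVec hz (S.polyBdd_stackMatrix_ray p hv.1 hnon)
          (S.polyBdd_single_rayIndex p hv.1 j).1) hg.1 hg.2
        (hne.mono fun x hx => p.single_ne_zero hx)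
        (hv.negligible_exp (by lia) hm hres).2 hB
      refine ⟨m + 1, 0, rfl, Or.inr ⟨by lia, hres⟩, by lia, ?_⟩
      simp only [stackMatrix, Matrix.one_mulVec]
      refine (step.congr ?_).mono fun _ => trivial
      filter_upwards [hne] with x hx
      rw [← Matrix.mulVec_mulVec, zero_add, S.layerChar_eq p hx (S.rayIndex_sq _ _), rayPhase]
    · refine ⟨j, i + 1, by lia, hj, fun k h1 h2 => ?_, ?_⟩
      · rcases Nat.lt_or_ge k (j + i + 1) with h3 | h3
        · exact hnon k h1 (by lia)
        · rwa [show k = m + 1 by lia]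
      · have := hF.mulVec hz (T := fun x : ℝ => S.layerChar p (a + x * v) (m + 1)) fun b c =>
          (S.analyticAt_layerChar p hres b c).meromorphicAt.polyBdd_ray hv.1
        simpa only [stackMatrix, Matrix.mulVec_mulVec, zero_add, hji] using this

/-- Along an attenuating ray towards a resonance the reduced denominator grows faster than any
power. -/
theorem negligible_inv_reducedDenom (hv : S.IsAttenuating a v) {j₀ : ℕ} (h1 : 1 ≤ j₀)
    (h2 : j₀ ≤ S.N) (h3 : (S.den j₀).eval a = 0) :
    (∀ᶠ x : ℝ in 𝓝[>] 0, S.reducedDenom p (a + x * v) ≠ 0) ∧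
      Negligible (𝓝[>] 0) (fun x : ℝ => x⁻¹) fun x : ℝ => (S.reducedDenom p (a + x * v))⁻¹ := by
  have hz := tendsto_inv_scale
  obtain ⟨j, i, hji, hj, hnon, hF⟩ := S.exists_follows_ray p hv le_rfl
  have hj1 : 1 ≤ j := by
    by_contra h
    exact hnon j₀ (by lia) (by lia) h3
  have hout : p.single (S.nOut : ℂ) ≠ 0 :=
    p.single_ne_zero (by exact_mod_cast S.nOut_pos.ne')
  have hB := S.polyInv_interfaceFactor p hv (j := j) (i := i) (by lia) hj (Or.inl hji)
    (by lia) hnon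
  have key := (hF.contract hz (c := fun _ => p.single (S.nOut : ℂ)) (d := fun _ => 1)
    (polyBdd_const _) (polyBdd_const _) ?_)
  · simpa only [reducedDenom, outField, one_mul] using And.intro key.1.1 (key.2 hj1)
  · refine ((polyInv_const hout).mul hB).congr (Eventually.of_forall fun x => ?_)
    have : S.rayIndex (j + i + 1) (a + x * v) = S.nOut := by
      rw [hji, rayIndex, if_neg (by lia), if_pos rfl]
    simp only [interfaceFactor, this]
    field_simp

end LorentzStack

/-! ### Upper bounds of order exp (O (1 / |ω - a|)) -/

section ExpBdd

variable {a : ℂ} {f g : ℂ → ℂ}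

/-- `f` has growth `exp (O (1 / |ω - a|))` near `a`. -/
def ExpBdd (a : ℂ) (f : ℂ → ℂ) : Prop :=
  ∃ C : ℝ, ∀ᶠ ω in 𝓝[≠] a, ‖f ω‖ ≤ Real.exp (C / ‖ω - a‖)

theorem eventually_norm_sub_mem_Ioc (a : ℂ) :
    ∀ᶠ ω in 𝓝[≠] a, 0 < ‖ω - a‖ ∧ ‖ω - a‖ ≤ 1 := by
  filter_upwards [self_mem_nhdsWithin,
    nhdsWithin_le_nhds (Metric.closedBall_mem_nhds a one_pos)] with ω h1 h2
  exact ⟨norm_pos_iff.2 (sub_ne_zero.2 h1), by simpa [dist_eq_norm] using h2⟩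

theorem ExpBdd.of_norm_le (hg : ExpBdd a g) (h : ∀ᶠ ω in 𝓝[≠] a, ‖f ω‖ ≤ ‖g ω‖) :
    ExpBdd a f := by
  obtain ⟨C, hC⟩ := hg
  refine ⟨C, ?_⟩
  filter_upwards [hC, h] with ω h1 h2 using h2.trans h1

theorem ExpBdd.mul (hf : ExpBdd a f) (hg : ExpBdd a g) : ExpBdd a fun ω => f ω * g ω := by
  obtain ⟨C, hC⟩ := hf
  obtain ⟨D, hD⟩ := hg
  refine ⟨C + D, ?_⟩
  filter_upwards [hC, hD] with ω h1 h2
  rw [norm_mul, add_div, Real.exp_add]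
  gcongr

theorem ExpBdd.add (hf : ExpBdd a f) (hg : ExpBdd a g) : ExpBdd a fun ω => f ω + g ω := by
  obtain ⟨C, hC⟩ := hf
  obtain ⟨D, hD⟩ := hg
  refine ⟨max C D + 1, ?_⟩
  filter_upwards [hC, hD, eventually_norm_sub_mem_Ioc a] with ω h1 h2 ⟨h3, h4⟩
  have e1 : ‖f ω‖ ≤ Real.exp (max C D / ‖ω - a‖) := h1.trans (by gcongr; exact le_max_left C D)
  have e2 : ‖g ω‖ ≤ Real.exp (max C D / ‖ω - a‖) := h2.trans (by gcongr; exact le_max_right C D)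
  have e3 : 2 ≤ Real.exp (1 / ‖ω - a‖) := by
    have h5 : 1 ≤ 1 / ‖ω - a‖ := by rwa [le_div_iff₀ h3, one_mul]
    linarith [Real.add_one_le_exp (1 / ‖ω - a‖)]
  rw [add_div, Real.exp_add]
  refine (norm_add_le _ _).trans ?_
  nlinarith [Real.exp_pos (max C D / ‖ω - a‖)]

theorem expBdd_of_tendsto {c : ℂ} (h : Tendsto f (𝓝[≠] a) (𝓝 c)) : ExpBdd a f := by
  refine ⟨‖c‖ + 1, ?_⟩
  filter_upwards [h.norm.eventually_lt_const (lt_add_one ‖c‖), eventually_norm_sub_mem_Ioc a]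
    with ω h1 ⟨h2, h3⟩
  have h4 : ‖c‖ + 1 ≤ (‖c‖ + 1) / ‖ω - a‖ := by
    rw [le_div_iff₀ h2]
    exact mul_le_of_le_one_right (by positivity) h3
  linarith [Real.add_one_le_exp ((‖c‖ + 1) / ‖ω - a‖)]

theorem expBdd_const (c : ℂ) : ExpBdd a fun _ => c :=
  expBdd_of_tendsto tendsto_const_nhds

theorem expBdd_inv_sub : ExpBdd a fun ω => (ω - a)⁻¹ := by
  refine ⟨1, Eventually.of_forall fun ω => ?_⟩
  rw [norm_inv, one_div]
  linarith [Real.add_one_le_exp ‖ω - a‖⁻¹]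

/-- An even function of exponential type in a square root of a function with at most a double
pole. -/
theorem expBdd_evenLift {F : ℂ → ℂ} {A : ℝ} (hA : 0 < A)
    (hF : ∀ z, ‖F z‖ ≤ A * Real.exp ‖z‖) {K : ℝ} (hK : 0 ≤ K)
    (h : ∀ᶠ ω in 𝓝[≠] a, ‖f ω‖ ≤ K / ‖ω - a‖ ^ 2) : ExpBdd a fun ω => evenLift F (f ω) := by
  have h1 : ExpBdd a fun ω => (A : ℂ) * ((Real.exp ((K + 1) / ‖ω - a‖) : ℝ) : ℂ) := by
    refine (expBdd_const (A : ℂ)).mul ⟨K + 1, Eventually.of_forall fun ω => ?_⟩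
    rw [Complex.norm_real, Real.norm_of_nonneg (Real.exp_pos _).le]
  refine h1.of_norm_le ?_
  filter_upwards [h, eventually_norm_sub_mem_Ioc a] with ω h2 ⟨h3, h4⟩
  rw [norm_mul, Complex.norm_real, Complex.norm_real, Real.norm_of_nonneg hA.le,
    Real.norm_of_nonneg (Real.exp_pos _).le, evenLift]
  refine (hF _).trans ?_
  gcongr
  rw [← sq_le_sq₀ (norm_nonneg _) (by positivity), ← norm_pow, cpow_half_sq, div_pow]
  refine h2.trans ?_
  gcongr
  nlinarith

end ExpBdd

theorem tendsto_add_sq (a : ℂ) : Tendsto (fun t : ℂ => a + t ^ 2) (𝓝[≠] 0) (𝓝[≠] a) := by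
  refine tendsto_nhdsWithin_iff.2 ⟨?_, ?_⟩
  · exact (Continuous.tendsto' (by fun_prop) _ _ (by simp)).mono_left nhdsWithin_le_nhds
  · filter_upwards [self_mem_nhdsWithin] with t ht
    simpa using ht

namespace LorentzStack

variable (S : LorentzStack) (p : Polarization)

/-- The denominators are constant or quadratic, so their zeros have order at most two. -/
theorem exists_mul_norm_sq_le_den {m : ℕ} (hm : m ≤ S.N + 1) (a : ℂ) :
    ∃ c : ℝ, 0 < c ∧ ∀ᶠ ω in 𝓝[≠] a, c * ‖ω - a‖ ^ 2 ≤ ‖(S.den m).eval ω‖ := by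
  by_cases ha : (S.den m).eval a = 0
  · obtain ⟨h1, h2, -⟩ := S.num_ne_zero_of_den_eq_zero hm ha
    have hden := S.eval_den_add h1 h2 ha
    set b : ℂ := 2 * a + Complex.I * S.damping m with hb
    have hden' : ∀ ω, ‖(S.den m).eval ω‖ = ‖ω - a‖ * ‖ω - a + b‖ := fun ω => by
      have := hden (ω - a)
      rw [add_sub_cancel] at this
      rw [this, norm_neg, norm_mul]
    by_cases hb0 : b = 0
    · refine ⟨1, one_pos, Eventually.of_forall fun ω => ?_⟩
      rw [hden', hb0, add_zero, one_mul, pow_two]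
    · have hbn : 0 < ‖b‖ := norm_pos_iff.2 hb0
      refine ⟨‖b‖ / 2, by positivity, ?_⟩
      have hlim : Tendsto (fun ω => ‖ω - a + b‖) (𝓝[≠] a) (𝓝 ‖b‖) :=
        (Continuous.tendsto' (by fun_prop) _ _ (by simp)).mono_left nhdsWithin_le_nhds
      filter_upwards [hlim.eventually_const_lt (half_lt_self hbn),
        eventually_norm_sub_mem_Ioc a] with ω h3 ⟨h4, h5⟩
      rw [hden']
      have : ‖b‖ / 2 * ‖ω - a‖ ≤ ‖ω - a + b‖ :=
        (mul_le_of_le_one_right (by positivity) h5).trans h3.le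
      nlinarith
  · have hn : 0 < ‖(S.den m).eval a‖ := norm_pos_iff.2 ha
    refine ⟨‖(S.den m).eval a‖ / 2, by positivity, ?_⟩
    have hlim : Tendsto (fun ω => ‖(S.den m).eval ω‖) (𝓝[≠] a) (𝓝 ‖(S.den m).eval a‖) :=
      (Continuous.tendsto' (by fun_prop) _ _ rfl).mono_left nhdsWithin_le_nhds
    filter_upwards [hlim.eventually_const_lt (half_lt_self hn),
      eventually_norm_sub_mem_Ioc a] with ω h3 ⟨h4, h5⟩
    refine (mul_le_of_le_one_right (by positivity) ?_).trans h3.le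
    exact pow_le_one₀ h4.le h5

theorem exists_norm_indexSq_mul_le {m : ℕ} (hm : m ≤ S.N + 1) (a : ℂ) {f : ℂ → ℂ}
    (hf : Continuous f) :
    ∃ K : ℝ, 0 ≤ K ∧ ∀ᶠ ω in 𝓝[≠] a, ‖S.indexSq m ω * f ω‖ ≤ K / ‖ω - a‖ ^ 2 := by
  obtain ⟨c, hc, hden⟩ := S.exists_mul_norm_sq_le_den hm a
  have hlim : Tendsto (fun ω => ‖(S.num m).eval ω * f ω‖) (𝓝[≠] a)
      (𝓝 ‖(S.num m).eval a * f a‖) :=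
    (Continuous.tendsto' (by fun_prop) _ _ rfl).mono_left nhdsWithin_le_nhds
  refine ⟨(‖(S.num m).eval a * f a‖ + 1) / c, by positivity, ?_⟩
  filter_upwards [hden, hlim.eventually_lt_const (lt_add_one _), eventually_norm_sub_mem_Ioc a]
    with ω h1 h2 ⟨h3, h4⟩
  rw [indexSq, div_mul_eq_mul_div, norm_div, div_div]
  gcongr

/-- The squared phase is O (1 / |ω - a|²), hence the phase O (1 / |ω - a|), and cos and `sinQuot`
are of exponential type. -/
theorem expBdd_layerChar {m : ℕ} (hm : m ≤ S.N + 1) (a : ℂ) (b c : Fin 2) :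
    ExpBdd a fun ω => S.layerChar p ω m b c := by
  obtain ⟨A, hA, hsin⟩ := exists_norm_sinQuot_le
  obtain ⟨K, hK, hw⟩ := S.exists_norm_indexSq_mul_le hm a
    (f := fun ω => (S.thickness m * ω / S.c : ℂ) ^ 2) (by fun_prop)
  obtain ⟨K', hK', hw'⟩ := S.exists_norm_indexSq_mul_le hm a (f := fun _ => 1) (by fun_prop)
  have h1 := expBdd_evenLift (F := Complex.cos) one_pos
    (fun z => by simpa using norm_cos_le_exp z) hK hw
  have h2 := expBdd_evenLift (F := sinQuot) hA hsin hK hw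
  have hκ : ExpBdd a fun ω => (S.thickness m * ω / S.c : ℂ) :=
    expBdd_of_tendsto ((Continuous.tendsto' (by fun_prop) _ _ rfl).mono_left nhdsWithin_le_nhds)
  have hind : ExpBdd a fun ω => S.indexSq m ω := by
    refine ((expBdd_const (K' : ℂ)).mul (expBdd_inv_sub.mul expBdd_inv_sub)).of_norm_le ?_
    filter_upwards [hw'] with ω h
    rw [mul_one] at h
    rw [norm_mul, norm_mul, norm_inv, Complex.norm_real, Real.norm_of_nonneg hK']
    refine h.trans (le_of_eq ?_)
    rw [div_eq_mul_inv, pow_two, mul_inv]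
  have h3 := (expBdd_const (a := a) (-Complex.I)).mul (hκ.mul h2)
  have h4 := (expBdd_const (a := a) (-Complex.I)).mul ((hind.mul hκ).mul h2)
  cases p <;> fin_cases b <;> fin_cases c <;> first | exact h1 | exact h3 | exact h4

theorem expBdd_reducedDenom (a : ℂ) : ExpBdd a (S.reducedDenom p) := by
  have hM : ∀ k, k ≤ S.N → ∀ b c, ExpBdd a fun ω => stackMatrix (S.layerChar p ω) 0 k b c := by
    intro k hk
    induction k with
    | zero => exact fun b c => expBdd_const _
    | succ k ih =>
      intro b c
      have hm := S.expBdd_layerChar p (by lia : 0 + k + 1 ≤ S.N + 1) a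
      have ih' := ih (by lia)
      simpa [stackMatrix, Matrix.mul_apply, Fin.sum_univ_two] using
        ((hm b 0).mul (ih' 0 c)).add ((hm b 1).mul (ih' 1 c))
  have hv : ∀ b, ExpBdd a fun ω => S.outField p ω b := fun b => by
    simpa [outField, Matrix.mulVec, dotProduct, Fin.sum_univ_two] using
      (hM _ le_rfl b 0).add ((hM _ le_rfl b 1).mul (expBdd_const (p.single S.nIn)))
  exact ((expBdd_const _).mul (hv 0)).add (hv 1)

/-! ### Holomorphic branches of the indices -/

/-- In the coordinate `t` with `ω = a + t²` the squared index has a holomorphic root. -/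
theorem exists_holomorphic_root {m : ℕ} (hm : m ≤ S.N + 1) (a : ℂ) :
    ∃ ρ : ℂ → ℂ, ∀ᶠ t in 𝓝[≠] (0 : ℂ), AnalyticAt ℂ ρ t ∧ ρ t ^ 2 = S.indexSq m (a + t ^ 2) := by
  have hmero := S.meromorphicAt_indexSq m a
  have hne : ∀ᶠ ω in 𝓝[≠] a, S.indexSq m ω ≠ 0 := by
    filter_upwards [S.eventually_not_mem_exceptional a] with ω hω
    have := S.not_mem_exceptional.1 hω m hm
    exact div_ne_zero this.1 this.2
  obtain ⟨g, hg, hga, hgeq⟩ := (meromorphicOrderAt_ne_top_iff hmero).1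
    ((meromorphicOrderAt_ne_top_iff_eventually_ne_zero hmero).2 hne)
  set k := (meromorphicOrderAt (S.indexSq m) a).untop₀
  obtain ⟨r, hr, hr2⟩ := exists_analyticAt_sq_eq hga
  have hsub : AnalyticAt ℂ (fun t : ℂ => a + t ^ 2) 0 := by fun_prop
  have hin : AnalyticAt ℂ (fun t : ℂ => r (g (a + t ^ 2))) 0 :=
    hr.comp_of_eq (hg.comp_of_eq hsub (by simp)) (by simp)
  -- With (ω - a)^k split off, ω - a = t² makes t^k a root of that factor, whatever the parity of k.
  refine ⟨fun t => t ^ k * r (g (a + t ^ 2)), ?_⟩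
  filter_upwards [nhdsWithin_le_nhds hin.eventually_analyticAt, (tendsto_add_sq a).eventually hgeq,
    self_mem_nhdsWithin] with t h1 h2 h3
  refine ⟨(analyticAt_id.zpow h3).mul h1, ?_⟩
  rw [h2, mul_pow, hr2, add_sub_cancel_left, smul_eq_mul]
  congr 1
  rw [← zpow_natCast, ← zpow_natCast, ← _root_.zpow_mul, ← _root_.zpow_mul, mul_comm k]

theorem exists_isHolomorphicBranch (a : ℂ) : ∃ ν, S.IsHolomorphicBranch a ν := by
  have h := fun m (hm : m ≤ S.N + 1) => S.exists_holomorphic_root hm a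
  choose! ρ hρ using h
  refine ⟨fun t m => if m = 0 then S.nIn else if m = S.N + 1 then S.nOut else ρ m t, ?_⟩
  have hall : ∀ᶠ t in 𝓝[≠] (0 : ℂ), ∀ m ∈ Finset.Icc 1 S.N,
      AnalyticAt ℂ (ρ m) t ∧ ρ m t ^ 2 = S.indexSq m (a + t ^ 2) := by
    rw [Filter.eventually_all_finset]
    intro m hm
    rw [Finset.mem_Icc] at hm
    exact hρ m (by lia)
  unfold IsHolomorphicBranch
  filter_upwards [hall] with t ht
  have hmid : ∀ m, 1 ≤ m → m ≤ S.N → ∀ s, (if m = 0 then (S.nIn : ℂ) else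
      if m = S.N + 1 then (S.nOut : ℂ) else ρ m s) = ρ m s := fun m h1 h2 s => by
    rw [if_neg (by lia), if_neg (by lia)]
  refine ⟨⟨by simp, by simp, fun m h1 h2 h3 => ?_⟩, fun m h1 h2 => ?_⟩
  · rw [hmid m h1 h2, (ht m (Finset.mem_Icc.2 ⟨h1, h2⟩)).2, S.indexSq_layer h1 h2 h3]
  · simp only [hmid m h1 h2]
    exact (ht m (Finset.mem_Icc.2 ⟨h1, h2⟩)).1

end LorentzStack

theorem analyticAt_wolter {g δ : ℂ → ℕ → ℂ} {x : ℂ} {k : ℕ}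
    (hg : ∀ m, m ≤ k + 1 → AnalyticAt ℂ (fun z => g z m) x)
    (hδ : ∀ m, 1 ≤ m → m ≤ k → AnalyticAt ℂ (fun z => δ z m) x) :
    AnalyticAt ℂ (fun z => (wolter (g z) (δ z) k).1) x ∧
      AnalyticAt ℂ (fun z => (wolter (g z) (δ z) k).2) x := by
  induction k with
  | zero =>
    have h0 := hg 0 (by lia)
    have h1 := hg 1 (by lia)
    exact ⟨h1.fun_sub h0, h1.fun_add h0⟩
  | succ k ih =>
    obtain ⟨h1, h2⟩ := ih (fun m hm => hg m (by lia)) fun m hm hm' => hδ m hm (by lia)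
    have h3 := hg (k + 1) (by lia)
    have h4 := hg (k + 2) (by lia)
    have h5 := hδ (k + 1) (by lia) le_rfl
    simp only [wolter]
    constructor <;> fun_prop

/-! ### Essential singularities and accumulation of natural modes -/

/-- A function whose inverse is negligible does not grow polynomially. -/
theorem Negligible.not_polyBdd {ι : Type*} {l : Filter ι} [l.NeBot] {z : ι → ℝ}
    (hz : Tendsto z l atTop) {f : ι → ℂ} (h0 : ∀ᶠ i in l, f i ≠ 0)
    (h : Negligible l z fun i => (f i)⁻¹) : ¬ PolyBdd l z f := by
  intro hf
  have h1 := (h.mul_polyBdd hz hf).tendsto_zero hz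
  have h2 : Tendsto (fun _ : ι => (1 : ℂ)) l (𝓝 0) := by
    refine h1.congr' ?_
    filter_upwards [h0] with i hi
    exact inv_mul_cancel₀ hi
  exact one_ne_zero (tendsto_nhds_unique tendsto_const_nhds h2)

namespace LorentzStack

variable (S : LorentzStack) (p : Polarization)

/-- The factor by which the squared denominator differs from the squared reduced denominator. -/
noncomputable def prefactor (ω : ℂ) : ℂ :=
  4 ^ S.N * ∏ m ∈ Finset.Icc 1 S.N, p.single (S.indexSq m ω)

theorem meromorphicAt_prefactor (ω : ℂ) : MeromorphicAt (S.prefactor p) ω :=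
  (MeromorphicAt.const _ _).fun_mul
    (MeromorphicAt.fun_prod fun m _ => p.meromorphicAt_single (S.meromorphicAt_indexSq m ω))

theorem prefactor_ne_zero {ω : ℂ} (h : ω ∉ S.exceptional) : S.prefactor p ω ≠ 0 := by
  refine mul_ne_zero (pow_ne_zero _ (by norm_num)) (Finset.prod_ne_zero_iff.2 fun m hm => ?_)
  rw [Finset.mem_Icc] at hm
  have := S.not_mem_exceptional.1 h m (by lia)
  exact p.single_ne_zero (div_ne_zero this.1 this.2)

theorem regular_of_not_mem {ω : ℂ} (h : ω ∉ S.exceptional) :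
    ∀ m, 1 ≤ m → m ≤ S.N → (S.den m).eval ω ≠ 0 ∧ (S.num m).eval ω ≠ 0 :=
  fun m _ h2 => (S.not_mem_exceptional.1 h m (by lia)).symm

theorem denominator_sq {ω : ℂ} {n : ℕ → ℂ} (hn : S.IsIndexAt ω n) (h : ω ∉ S.exceptional) :
    S.denominator p ω n ^ 2 = S.prefactor p ω * S.reducedDenom p ω ^ 2 :=
  S.denominator_sq_eq p hn (S.regular_of_not_mem h)

theorem analyticAt_prefactor_mul {ω : ℂ} (h : ω ∉ S.exceptional) :
    AnalyticAt ℂ (fun z => S.prefactor p z * S.reducedDenom p z ^ 2) ω := by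
  have hreg := S.regular_of_not_mem h
  refine AnalyticAt.fun_mul (analyticAt_const.fun_mul (Finset.analyticAt_fun_prod _ fun m hm => ?_))
    ((S.analyticAt_reducedDenom p fun m h1 h2 => (hreg m h1 h2).1).fun_pow 2)
  rw [Finset.mem_Icc] at hm
  have := hreg m hm.1 hm.2
  exact p.analyticAt_single (S.analyticAt_indexSq this.1) (div_ne_zero this.2 this.1)

/-- `n` need not be continuous in ω; its signs drop out of the square. -/
theorem denominator_sq_eventuallyEq {n : ℂ → ℕ → ℂ} (hn : ∀ ω, S.IsIndexAt ω (n ω)) (a : ℂ) :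
    (fun ω => S.prefactor p ω * S.reducedDenom p ω ^ 2) =ᶠ[𝓝[≠] a]
      fun ω => S.denominator p ω (n ω) ^ 2 := by
  filter_upwards [S.eventually_not_mem_exceptional a] with ω hω
  exact (S.denominator_sq p (hn ω) hω).symm

theorem eventually_analyticAt_denominator_sq {n : ℂ → ℕ → ℂ} (hn : ∀ ω, S.IsIndexAt ω (n ω))
    (a : ℂ) : ∀ᶠ ω in 𝓝[≠] a, AnalyticAt ℂ (fun ω => S.denominator p ω (n ω) ^ 2) ω := by
  filter_upwards [S.eventually_not_mem_exceptional a] with ω hω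
  refine (S.analyticAt_prefactor_mul p hω).congr ?_
  have hopen : IsOpen ((S.exceptional : Set ℂ)ᶜ) := S.exceptional.finite_toSet.isClosed.isOpen_compl
  filter_upwards [hopen.mem_nhds hω] with z hz
  exact (S.denominator_sq p (hn z) hz).symm

/-- Off the resonances the reduced denominator is holomorphic even where an index vanishes, so any
pole comes from the prefactor. -/
theorem meromorphicAt_denominator_sq {n : ℂ → ℕ → ℂ} (hn : ∀ ω, S.IsIndexAt ω (n ω)) {a : ℂ}
    (ha : ∀ j, ¬ S.IsResonance j a) :
    MeromorphicAt (fun ω => S.denominator p ω (n ω) ^ 2) a := by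
  have hH : AnalyticAt ℂ (S.reducedDenom p) a := S.analyticAt_reducedDenom p fun m h1 h2 h => by
    rw [S.den_layer h1 h2] at h
    exact ha m ⟨h1, h2, h⟩
  exact ((S.meromorphicAt_prefactor p a).fun_mul (hH.meromorphicAt.fun_pow 2)).congr
    (S.denominator_sq_eventuallyEq p hn a)

/-- Near a resonance the squared denominator does not grow polynomially on a suitable ray. -/
theorem not_polyBdd_prefactor_mul {j : ℕ} {a : ℂ} (h : S.IsResonance j a) :
    ∃ v : ℂ, v ≠ 0 ∧ ¬ PolyBdd (𝓝[>] 0) (fun x : ℝ => x⁻¹) fun x : ℝ =>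
      S.prefactor p (a + x * v) * S.reducedDenom p (a + x * v) ^ 2 := by
  obtain ⟨v, hv, -⟩ := S.exists_isAttenuating a
  have hres : (S.den j).eval a = 0 := by rw [S.den_layer h.1 h.2.1, h.2.2]
  have hgrow := S.negligible_inv_reducedDenom p hv h.1 h.2.1 hres
  refine ⟨v, hv.1, fun hb => hgrow.2.not_polyBdd tendsto_inv_scale hgrow.1
    (PolyBdd.of_sq tendsto_inv_scale ?_)⟩
  refine (hb.mul ((S.meromorphicAt_prefactor p a).fun_inv.polyBdd_ray hv.1)).congr ?_
  filter_upwards [(tendsto_ray hv.1).eventually (S.eventually_not_mem_exceptional a)] with x hx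
  have := S.prefactor_ne_zero p hx
  field_simp

theorem isEssentialSingularity_denominator_sq {n : ℂ → ℕ → ℂ} (hn : ∀ ω, S.IsIndexAt ω (n ω))
    {j : ℕ} {a : ℂ} (h : S.IsResonance j a) :
    IsEssentialSingularity (fun ω => S.denominator p ω (n ω) ^ 2) a := by
  refine ⟨S.eventually_analyticAt_denominator_sq p hn a, fun hm => ?_⟩
  obtain ⟨v, hv, hnot⟩ := S.not_polyBdd_prefactor_mul p h
  exact hnot ((hm.congr (S.denominator_sq_eventuallyEq p hn a).symm).polyBdd_ray hv)

/-- The ray t = √x u with u² = v lies over the ray ω = a + x v, and polynomial growth in 1 / √x is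
polynomial growth in 1 / x. -/
theorem isEssentialSingularity_branch {j : ℕ} {a : ℂ} (h : S.IsResonance j a) {ν : ℂ → ℕ → ℂ}
    (hν : S.IsHolomorphicBranch a ν) :
    IsEssentialSingularity (fun t => S.denominator p (a + t ^ 2) (ν t)) 0 := by
  have hexc := (tendsto_add_sq a).eventually (S.eventually_not_mem_exceptional a)
  refine ⟨?_, fun hm => ?_⟩
  · have hν' := hν
    unfold IsHolomorphicBranch at hν'
    filter_upwards [hν', eventually_eventually_nhdsWithin.2 hν', self_mem_nhdsWithin, hexc]
      with t h1 h2 h3 h4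
    have h2' : ∀ᶠ s in 𝓝 t, S.IsIndexAt (a + s ^ 2) (ν s) := by
      rw [← isOpen_compl_singleton.nhdsWithin_eq h3]
      exact h2.mono fun s hs => hs.1
    have hne := (S.denominator_eq p h1.1 (S.regular_of_not_mem h4)).1
    have hcoeff : ∀ m, m ≤ S.N + 1 → AnalyticAt ℂ (fun s => p.coeff (ν s) m) t := by
      intro m hm
      simp only [p.coeff_eq_single]
      by_cases hm0 : m = 0
      · refine (analyticAt_const (v := p.single S.nIn)).congr ?_
        filter_upwards [h2'] with s hs
        rw [hm0, hs.left]
      by_cases hmN : m = S.N + 1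
      · refine (analyticAt_const (v := p.single S.nOut)).congr ?_
        filter_upwards [h2'] with s hs
        rw [hmN, hs.right]
      exact p.analyticAt_single (h1.2 m (by lia) (by lia)) (hne m (by lia) (by lia)).1
    refine (analyticAt_wolter (g := fun s => p.coeff (ν s))
      (δ := fun s => S.phase (a + s ^ 2) (ν s)) hcoeff fun m hm1 hm2 => ?_).2
    have := h1.2 m hm1 hm2
    have hc : (S.c : ℂ) ≠ 0 := by exact_mod_cast S.c_pos.ne'
    simp only [phase]
    exact ((this.fun_mul analyticAt_const).fun_mul (by fun_prop)).fun_div analyticAt_const hc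
  · obtain ⟨v, hv, hnot⟩ := S.not_polyBdd_prefactor_mul p h
    set u : ℂ := v ^ (1 / 2 : ℂ) with hu
    have hu2 : u ^ 2 = v := cpow_half_sq v
    have hu0 : u ≠ 0 := by
      rintro h0
      rw [h0, zero_pow two_ne_zero] at hu2
      exact hv hu2.symm
    obtain ⟨k, hk⟩ := (hm.fun_pow 2).polyBdd_ray hu0
    refine hnot ⟨k, ?_⟩
    have hsqrt : Tendsto (fun x : ℝ => √x) (𝓝[>] 0) (𝓝[>] 0) := by
      refine tendsto_nhdsWithin_iff.2 ⟨?_, ?_⟩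
      · exact (Continuous.tendsto' (by fun_prop) _ _ (by simp)).mono_left nhdsWithin_le_nhds
      · filter_upwards [self_mem_nhdsWithin] with x hx
        exact Real.sqrt_pos.2 hx
    have hcomp := hk.comp_tendsto hsqrt
    have hle : (fun x : ℝ => (√x)⁻¹ ^ k) =O[𝓝[>] 0] fun x : ℝ => x⁻¹ ^ k := by
      refine IsBigO.of_bound 1 ?_
      filter_upwards [Ioo_mem_nhdsGT one_pos] with x hx
      have hx0 : 0 < x := hx.1
      have hxs : x ≤ √x := Real.le_sqrt_of_sq_le (by nlinarith [hx.2])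
      rw [one_mul, norm_pow, norm_pow, norm_inv, norm_inv, Real.norm_of_nonneg hx0.le,
        Real.norm_of_nonneg (Real.sqrt_nonneg x)]
      gcongr
    refine IsBigO.trans (hcomp.congr' ?_ .rfl) hle
    have hν' := hν
    unfold IsHolomorphicBranch at hν'
    filter_upwards [hsqrt.eventually ((tendsto_ray (a := 0) hu0).eventually (hν'.and hexc)),
      self_mem_nhdsWithin] with x h1 hx
    have hx : 0 < x := hx
    have hsq : (a + (0 + (√x : ℂ) * u) ^ 2) = a + x * v := by
      rw [zero_add, mul_pow, hu2, ← Complex.ofReal_pow, Real.sq_sqrt hx.le]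
    have h2 := S.denominator_sq p h1.1.1 h1.2
    simp only [Function.comp_apply]
    rw [h2, hsq]

/-- Natural mode frequencies accumulate at every resonance. -/
theorem infinite_naturalModes {n : ℂ → ℕ → ℂ} (hn : ∀ ω, S.IsIndexAt ω (n ω)) {j : ℕ} {a : ℂ}
    (h : S.IsResonance j a) {U : Set ℂ} (hU : U ∈ 𝓝 a) :
    {ω | ω ∈ U ∧ S.IsNaturalMode p n ω}.Infinite := by
  intro hfin
  obtain ⟨v, hv, hv'⟩ := S.exists_isAttenuating a
  have hres : (S.den j).eval a = 0 := by rw [S.den_layer h.1 h.2.1, h.2.2]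
  have hanalytic : ∀ᶠ ω in 𝓝[≠] a, AnalyticAt ℂ (S.reducedDenom p) ω := by
    filter_upwards [S.eventually_not_mem_exceptional a] with ω hω
    exact S.analyticAt_reducedDenom p fun m h1 h2 => (S.regular_of_not_mem hω m h1 h2).1
  have hfreq := frequently_eq_zero_of_growth hv.1 hanalytic (S.expBdd_reducedDenom p a)
    (S.negligible_inv_reducedDenom p hv h.1 h.2.1 hres).2
    (S.negligible_inv_reducedDenom p hv' h.1 h.2.1 hres).2
  refine hfreq ?_
  -- Off the finite exceptional set every zero of the reduced denominator is a natural mode, so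
  -- finitely many modes would leave a punctured neighbourhood free of zeros.
  filter_upwards [hfin.eventually_notMem_nhdsNE a, nhdsWithin_le_nhds hU,
    S.eventually_not_mem_exceptional a] with ω h1 h2 h3 h4
  have hreg := S.regular_of_not_mem h3
  obtain ⟨h5, h6⟩ := S.denominator_eq p (hn ω) hreg
  refine h1 ⟨h2, fun m hm1 hm2 => ⟨?_, (h5 m hm1 hm2).1⟩, ?_⟩
  · rw [← S.den_layer hm1 hm2]
    exact (hreg m hm1 hm2).1
  · rw [h6, h4, mul_zero]

end LorentzStack

theorem mainTheorem1 (S : LorentzStack) (p : Polarization)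
    (n : ℂ → ℕ → ℂ) (hn : ∀ ω, S.IsIndexAt ω (n ω)) :
    (∀ (j : ℕ) (a : ℂ), S.IsResonance j a →
      IsEssentialSingularity (fun ω => S.denominator p ω (n ω) ^ 2) a ∧
      (∃ ν, S.IsHolomorphicBranch a ν) ∧
      (∀ ν, S.IsHolomorphicBranch a ν →
        IsEssentialSingularity (fun t => S.denominator p (a + t ^ 2) (ν t)) 0) ∧
      ∀ U ∈ 𝓝 a, {ω | ω ∈ U ∧ S.IsNaturalMode p n ω}.Infinite) ∧
    (∀ a : ℂ, (∀ j, ¬ S.IsResonance j a) →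
      MeromorphicAt (fun ω => S.denominator p ω (n ω) ^ 2) a) :=
  ⟨fun _ a h => ⟨S.isEssentialSingularity_denominator_sq p hn h, S.exists_isHolomorphicBranch a,
    fun _ hν => S.isEssentialSingularity_branch p h hν,
    fun _ hU => S.infinite_naturalModes p hn h hU⟩,
    fun _ ha => S.meromorphicAt_denominator_sq p hn ha⟩
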